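/- **Setting.** Let $(\mathcal S,\mathcal A,\mathcal B,\sigma,p,\gamma)$ be a two-player zero-sum discounted Markov game: $\mathcal S$ (states), $\mathcal A$, $\mathcal B$ (actions of Players 1 and 2) are finite, $\sigma(s,a,b)\in[0,1]$ is the loss of Player 1, $p(\cdot\mid s,a,b)$ is a probability distribution on $\mathcal S$, and $\tfrac12\le\gamma<1$. A stationary policy of Player 1 is $x=(x^s)_{s\in\mathcal S}$ with $x^s\in\Delta_{\mathcal A}$ (the probability simplex), similarly $y=(y^s)_s$ with $y^s\in\Delta_{\mathcal B}$ for Player 2, and $$V^s_{x,y}=\mathbb E\Big[\sum_{t\ge1}\gamma^{t-1}\sigma(s_t,a_t,b_t)\Big],\qquad s_1=s,\ a_t\sim x^{s_t},\ b_t\sim y^{s_t},\ s_{t+1}\sim p(\cdot\mid s_t,a_t,b_t).$$ Norms are Euclidean and $\Pi_U$ denotes Euclidean projection onto $U$. Fix a stationary policy $y$ of Player 2, and let $\mathcal X_{BR}=\{x: V^s_{x,y}=\min_{x'}V^s_{x',y}\ \forall s\}$ and $\mathcal X_{BR}^s=\{x^s: x\in\mathcal X_{BR}\}$. **Algorithm.**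 Let $0<\eta\le 10^{-4}\sqrt{(1-\gamma)^5/|\mathcal S|}$, $\varepsilon\in[0,\frac1{1-\gamma}]$, $H=\frac2{1-\gamma}$, $\alpha_t=\frac{H+1}{H+t}$. Player 1 chooses arbitrary $\widehat x_1^s=x_1^s\in\Delta_{\mathcal A}$, sets $V_0^s=0$, and for $t=1,\dots,T$ and all $s$, with $Q_t^s(a,b)=\sigma(s,a,b)+\gamma\,\mathbb E_{s'\sim p(\cdot\mid s,a,b)}[V_{t-1}^{s'}]$, sets $$\widehat x_{t+1}^s=\Pi_{\Delta_{\mathcal A}}\{\widehat x_t^s-\eta\ell_t^s\},\quad x_{t+1}^s=\Pi_{\Delta_{\mathcal A}}\{\widehat x_{t+1}^s-\eta\ell_t^s\},\quad V_t^s=(1-\alpha_t)V_{t-1}^s+\alpha_t\rho_t^s,$$ where $\ell_t^s,\rho_t^s$ are any estimates with $\|\ell_t^s-Q_t^sy^s\|\le\varepsilon$ and $|\rho_t^s-x_t^{s\top}Q_t^sy^s|\le\varepsilon$. **Theorem.** There is a universal constant $K>0$ such that for every such game, every stationary $y$, all $\eta,\varepsilon$ as above and every execution of the algorithm the following hold.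 1. For all $T\ge2$, $$\frac1T\sum_{t=1}^T\max_{s,x'}\big(V^s_{\widehat x_t,y}-V^s_{x',y}\big)\le K\left(\frac{|\mathcal S|}{\eta(1-\gamma)^2}\sqrt{\frac{\log T}{T}}+\frac{|\mathcal S|\sqrt\varepsilon}{\sqrt\eta\,(1-\gamma)^2}\right).$$ 2. Let $Q_\star^s(a,b)=\sigma(s,a,b)+\gamma\,\mathbb E_{s'\sim p(\cdot\mid s,a,b)}[\min_{x'}V^{s'}_{x',y}]$. There exists a constant $C'>0$, depending only on the game and $y$, such that $$\max_{v'\in\Delta_{\mathcal A}}(v-v')^\top Q_\star^s y^s\ \ge\ C'\,\mathrm{dist}(v,\mathcal X_{BR}^s)\qquad\text{for all } s\in\mathcal S,\ v\in\Delta_{\mathcal A},$$ and for every such $C'$ and all $T\ge1$, the projections of the $\widehat x_T^s$ onto the sets $\mathcal X_{BR}^s$ exist, together form a policy in $\mathcal X_{BR}$, and satisfy $$\frac1{|\mathcal S|}\sum_{s\in\mathcal S}\big\|\widehat x_T^s-\Pi_{\mathcal X_{BR}^s}\{\widehat x_T^s\}\big\|^2\le K\left(\frac{|\mathcal S|^2}{\eta^4C'^4(1-\gamma)^4T}+\frac{\varepsilon}{\eta\,C'^2(1-\gamma)^3}\right).$$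 -/

import Mathlib

open MeasureTheory ProbabilityTheory Matrix

universe u v w

noncomputable section

namespace ZeroSum

/-- The probability simplex over a finite set, inside Euclidean space (so that `‖·‖` is the
`L₂` norm). -/
def simplex (ι : Type*) [Fintype ι] : Set (EuclideanSpace ℝ ι) :=
  {v | v.ofLp ∈ stdSimplex ℝ ι}

/-- `u` is the Euclidean projection of `v` onto the set `U`: a point of `U` nearest to `v`. -/
def IsProj {E : Type*} [NormedAddCommGroup E] (U : Set E) (v u : E) : Prop :=
  u ∈ U ∧ ∀ w ∈ U, ‖u - v‖ ≤ ‖w - v‖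

/-- A two-player zero-sum discounted Markov game with state set `S` and action sets `A`, `B`. -/
structure MarkovGame (S : Type u) (A : Type v) (B : Type w) [Fintype S] where
  /-- The loss of Player 1, which is the payoff of Player 2. -/
  loss : S → A → B → ℝ
  loss_mem : ∀ s a b, loss s a b ∈ Set.Icc (0 : ℝ) 1
  /-- `trans s a b s'` is the probability of moving from `s` to `s'` under actions `a`, `b`. -/
  trans : S → A → B → simplex S
  /-- The discount factor. -/
  γ : ℝ
  γ_mem : γ ∈ Set.Ico (1 / 2 : ℝ) 1

/-- A stationary policy: a distribution over actions for every state. -/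
abbrev Policy (S : Type*) (A : Type*) [Fintype A] := S → simplex A

/-- One time step of a play: the current state and the two actions taken there. -/
structure Step (S : Type u) (A : Type v) (B : Type w) where
  state : S
  act₁ : A
  act₂ : B

instance (S : Type u) (A : Type v) (B : Type w) : MeasurableSpace (Step S A B) := ⊤

instance (S : Type u) (A : Type v) (B : Type w) : DiscreteMeasurableSpace (Step S A B) :=
  ⟨fun _ => trivial⟩

variable {S : Type u} {A : Type v} {B : Type w} [Fintype S] [Fintype A] [Fintype B]

/-- The law of the step taken at state `s`: `a ∼ x^s` and `b ∼ y^s` independently. -/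
def stepLaw (x : Policy S A) (y : Policy S B) (s : S) : Measure (Step S A B) :=
  ∑ a, ∑ b, ENNReal.ofReal ((x s).1 a * (y s).1 b) • Measure.dirac ⟨s, a, b⟩

instance (x : Policy S A) (y : Policy S B) (s : S) : IsProbabilityMeasure (stepLaw x y s) := by
  constructor
  have hx := (x s).2
  have hy := (y s).2
  simp only [simplex, Set.mem_ofPred_eq, stdSimplex] at hx hy
  have h : ∀ a b, 0 ≤ (x s).1 a * (y s).1 b := fun a b => mul_nonneg (hx.1 a) (hy.1 b)
  simp only [stepLaw, Measure.finsetSum_apply, Measure.smul_apply, measure_univ, smul_eq_mul,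
    mul_one]
  simp_rw [← ENNReal.ofReal_sum_of_nonneg (fun b _ => h _ b)]
  rw [← ENNReal.ofReal_sum_of_nonneg (fun a _ => Finset.sum_nonneg fun b _ => h a b)]
  simp_rw [← Finset.mul_sum]
  rw [hy.2, ← Finset.sum_mul, hx.2]
  simp

namespace MarkovGame

variable (G : MarkovGame S A B)

/-- The law of the next step after the step `q`: `s' ∼ p(· | s, a, b)`, then `a' ∼ x^{s'}` and
`b' ∼ y^{s'}`. -/
def nextLaw (x : Policy S A) (y : Policy S B) (q : Step S A B) : Measure (Step S A B) :=
  ∑ s', ENNReal.ofReal ((G.trans q.state q.act₁ q.act₂).1 s') • stepLaw x y s'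

/-- The Markov kernel `q ↦ nextLaw q`. -/
def nextKernel (x : Policy S A) (y : Policy S B) : Kernel (Step S A B) (Step S A B) where
  toFun := G.nextLaw x y
  measurable' := measurable_from_top

instance (x : Policy S A) (y : Policy S B) : IsMarkovKernel (G.nextKernel x y) := by
  constructor
  intro q
  constructor
  have hp := (G.trans q.state q.act₁ q.act₂).2
  simp only [simplex, Set.mem_ofPred_eq, stdSimplex] at hp
  change G.nextLaw x y q Set.univ = 1
  simp only [nextLaw, Measure.finsetSum_apply, Measure.smul_apply, measure_univ, smul_eq_mul,
    mul_one]
  rw [← ENNReal.ofReal_sum_of_nonneg (fun a _ => hp.1 a), hp.2]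
  simp

/-- The kernel giving step `n + 1` from the history up to step `n`; it only looks at step `n`. -/
def historyKernel (x : Policy S A) (y : Policy S B) (n : ℕ) :
    Kernel (Π _ : Finset.Iic n, Step S A B) (Step S A B) :=
  (G.nextKernel x y).comap (fun h => h ⟨n, Finset.mem_Iic.2 le_rfl⟩) (measurable_pi_apply _)

instance (x : Policy S A) (y : Policy S B) (n : ℕ) : IsMarkovKernel (G.historyKernel x y n) := by
  unfold historyKernel
  infer_instance

/-- The law of the infinite play started at `s` when the players use `x` and `y`. -/
def playLaw (x : Policy S A) (y : Policy S B) (s : S) : Measure (ℕ → Step S A B) :=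
  Kernel.trajMeasure (X := fun _ => Step S A B) (stepLaw x y s) (G.historyKernel x y)

/-- The value `V^s_{x,y}`: the expected discounted total loss. -/
def value (x : Policy S A) (y : Policy S B) (s : S) : ℝ :=
  ∫ ω, ∑' t : ℕ, G.γ ^ t * G.loss (ω t).state (ω t).act₁ (ω t).act₂ ∂(G.playLaw x y s)

/-- The matrix `Q(a,b) = σ(s,a,b) + γ 𝔼_{s' ∼ p(·|s,a,b)}[V^{s'}]` for a vector `V` of
state values. -/
def qMatrix (V : S → ℝ) (s : S) : Matrix A B ℝ :=
  Matrix.of fun a b => G.loss s a b + G.γ * ∑ s', (G.trans s a b).1 s' * V s'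

/-- The set of best responses to `y`: policies attaining `min_{x'} V^s_{x',y}` at every state. -/
def bestResponses (y : Policy S B) : Set (Policy S A) :=
  {x | ∀ s, ∀ x' : Policy S A, G.value x y s ≤ G.value x' y s}

/-- The action distributions which best responses to `y` use at the state `s`. -/
def bestResponsesAt (y : Policy S B) (s : S) : Set (EuclideanSpace ℝ A) :=
  {v | ∃ x ∈ G.bestResponses y, (x s).1 = v}

/-- The value `min_{x'} V^s_{x',y}` of best responding to `y`. -/
def bestValue (y : Policy S B) (s : S) : ℝ := ⨅ x' : Policy S A, G.value x' y s

/-- `C` satisfies, for all states `s` and all `x^s` in the simplex,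
`max_{x'} (x^s - x'^s)ᵀ Q⋆^s y^s ≥ C * dist(x^s, X_BR^s)`, where `Q⋆` is the matrix of the best
response values. It is the error-bound constant of the game in which the opponent is frozen to `y`;
it depends on nothing but the game and `y`. -/
def IsErrorBoundConst (y : Policy S B) (C : ℝ) : Prop :=
  ∀ (s : S) (v : simplex A),
    C * Metric.infDist v.1 (G.bestResponsesAt y s) ≤
      ⨆ v' : simplex A,
        (v.1.ofLp ⬝ᵥ (G.qMatrix (G.bestValue y) s *ᵥ (y s).1.ofLp) -
          v'.1.ofLp ⬝ᵥ (G.qMatrix (G.bestValue y) s *ᵥ (y s).1.ofLp))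

/-- The critic's learning rate `α_t = (H + 1) / (H + t)` with `H = 2 / (1 - γ)`. -/
def rate (t : ℕ) : ℝ := (2 / (1 - G.γ) + 1) / (2 / (1 - G.γ) + t)

/-- An execution of `T` iterations (`t = 1, …, T`) of optimistic gradient descent with a slow critic
by Player 1, while Player 2 plays the stationary policy `y`. The estimates `ℓ` and `ρ` are arbitrary
up to accuracy `ε`. Entries with index `0` (other than `V 0`) or index beyond `T + 1` play no role. -/
structure SinglePlayerRun (y : Policy S B) (η ε : ℝ) (T : ℕ) where
  η_pos : 0 < η
  η_le : η ≤ 1 / 10 ^ 4 * √((1 - G.γ) ^ 5 / (Fintype.card S : ℝ))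
  ε_nonneg : 0 ≤ ε
  ε_le : ε ≤ 1 / (1 - G.γ)
  /-- The iterates `x̂_t`. -/
  xhat : ℕ → Policy S A
  /-- The iterates `x_t`. -/
  x : ℕ → Policy S A
  /-- The critic's values `V_t`. -/
  V : ℕ → S → ℝ
  /-- The loss estimates `ℓ_t`. -/
  l : ℕ → S → EuclideanSpace ℝ A
  /-- The value estimates `ρ_t`. -/
  ρ : ℕ → S → ℝ
  x_init : xhat 1 = x 1
  V_init : ∀ s, V 0 s = 0
  l_approx : ∀ t ∈ Finset.Icc 1 T, ∀ s,
    ‖l t s - WithLp.toLp 2 (G.qMatrix (V (t - 1)) s *ᵥ (y s).1.ofLp)‖ ≤ ε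
  ρ_approx : ∀ t ∈ Finset.Icc 1 T, ∀ s,
    |ρ t s - (x t s).1.ofLp ⬝ᵥ (G.qMatrix (V (t - 1)) s *ᵥ (y s).1.ofLp)| ≤ ε
  xhat_update : ∀ t ∈ Finset.Icc 1 T, ∀ s,
    IsProj (simplex A) ((xhat t s).1 - η • l t s) (xhat (t + 1) s).1
  x_update : ∀ t ∈ Finset.Icc 1 T, ∀ s,
    IsProj (simplex A) ((xhat (t + 1) s).1 - η • l t s) (x (t + 1) s).1
  V_update : ∀ t ∈ Finset.Icc 1 T, ∀ s,
    V t s = (1 - G.rate t) * V (t - 1) s + G.rate t * ρ t s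

end MarkovGame

end ZeroSum

end

set_option linter.unusedSectionVars false

noncomputable section

namespace ZeroSum

variable {S : Type u} {A : Type v} {B : Type w} [Fintype S] [Fintype A] [Fintype B]

/-! Against a frozen `y`, Player 1 faces a discounted Markov decision process. Its optimal value
`bestValue` solves the Bellman optimality equation, and a policy is a best response exactly when at
every state it has zero `gap`, that is, puts mass only on actions minimising `qFun y (bestValue y)
s`. Hence the best responses form a product of faces of simplices, and statewise estimates suffice.

The heart of the argument is that the critic converges at rate `1 / t`: `|V t s - bestValue y s| ≤
criticBound η ε t`, of order `1 / (η (1 - γ)² t) + ε / (1 - γ)`. The lower side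
(`bestValue_sub_V_le`) is contraction alone, since no policy beats the optimal value. The upper side
(`V_sub_bestValue_add_le`) needs the actor: the critic's excess is coupled with the squared distance
to a best response, weighted by `rate t / (2η)`. The regret inequality (`optimism_error_le`) makes
the distances telescope. What the changing weights leave over and what the drift of the losses costs
are both `O(1 / t)`.

The iterates `xhat` then perform projected gradient steps on a fixed linear loss with `O(1 / t)`
perturbations (`two_mul_gap_le`). Summing gives total gap `O(log T)`, and a policy's suboptimality
is at most its largest gap over `1 - γ`; this is the first claim. For the second, the gap grows
linearly off the optimal face, because the actions are finitely many. As distances are at most `2`,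
this linear error bound implies a quadratic one, so squared distances contract by `1 + η C` per
step, and `le_div_add_of_recursion` gives a `1 / T` last-iterate rate. -/

instance : Finite (Step S A B) :=
  Finite.of_injective (fun q : Step S A B => (q.state, q.act₁, q.act₂)) <| by
    rintro ⟨⟩ ⟨⟩ h
    simpa using h

/-! ### Expectations under the law of the play, and the Bellman equation. -/

lemma integral_stepLaw (x : Policy S A) (y : Policy S B) (s : S) (f : Step S A B → ℝ) :
    ∫ q, f q ∂(stepLaw x y s) = ∑ a, ∑ b, (x s).1 a * (y s).1 b * f ⟨s, a, b⟩ := by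
  have hi : ∀ (a : A) (b : B), Integrable f
      (ENNReal.ofReal ((x s).1 a * (y s).1 b) • Measure.dirac (⟨s, a, b⟩ : Step S A B)) :=
    fun a b => (integrable_dirac (by simp)).smul_measure ENNReal.ofReal_ne_top
  rw [stepLaw, integral_finsetSum_measure
    (fun a _ => integrable_finsetSum_measure.2 fun b _ => hi a b)]
  refine Finset.sum_congr rfl fun a _ => ?_
  rw [integral_finsetSum_measure (fun b _ => hi a b)]
  refine Finset.sum_congr rfl fun b _ => ?_
  rw [integral_smul_measure, integral_dirac,
    ENNReal.toReal_ofReal (mul_nonneg ((x s).2.1 a) ((y s).2.1 b)), smul_eq_mul]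

namespace MarkovGame

variable (G : MarkovGame S A B) (x : Policy S A) (y : Policy S B)

lemma integral_nextLaw (q : Step S A B) (f : Step S A B → ℝ) :
    ∫ r, f r ∂(G.nextLaw x y q) =
      ∑ s', (G.trans q.state q.act₁ q.act₂).1 s' * ∫ r, f r ∂(stepLaw x y s') := by
  rw [nextLaw, integral_finsetSum_measure
    (fun s' _ => (Integrable.of_finite).smul_measure ENNReal.ofReal_ne_top)]
  refine Finset.sum_congr rfl fun s' _ => ?_
  rw [integral_smul_measure,
    ENNReal.toReal_ofReal ((G.trans q.state q.act₁ q.act₂).2.1 s'), smul_eq_mul]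

instance (s : S) : IsProbabilityMeasure (G.playLaw x y s) := by
  unfold playLaw; infer_instance

lemma integral_playLaw_zero (s : S) (f : Step S A B → ℝ) :
    ∫ ω, f (ω 0) ∂(G.playLaw x y s) = ∫ q, f q ∂(stepLaw x y s) := by
  have h : (G.playLaw x y s).map (fun ω => ω 0) = stepLaw x y s := by
    have h1 : (G.playLaw x y s).map (Preorder.frestrictLe 0) =
        (stepLaw x y s).map (MeasurableEquiv.piUnique (fun _ : Finset.Iic 0 => Step S A B)).symm := by
      rw [playLaw, Kernel.trajMeasure, Measure.map_comp _ _ (by fun_prop),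
        Kernel.traj_map_frestrictLe, Kernel.partialTraj_self, Measure.id_comp]
    have h2 : (fun ω : ℕ → Step S A B => ω 0) =
        (fun h : (Π _ : Finset.Iic 0, Step S A B) => h ⟨0, by simp⟩) ∘ Preorder.frestrictLe 0 := rfl
    rw [h2, ← Measure.map_map (by fun_prop) (by fun_prop), h1,
      Measure.map_map (by fun_prop) (by fun_prop)]
    have h3 : (fun h : (Π _ : Finset.Iic 0, Step S A B) => h ⟨0, by simp⟩) ∘
        (MeasurableEquiv.piUnique (fun _ : Finset.Iic 0 => Step S A B)).symm = id := by
      funext q; rfl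
    rw [h3, Measure.map_id]
  rw [← h, integral_map (measurable_pi_apply 0).aemeasurable
    Measurable.of_discrete.aestronglyMeasurable]

/-- The Markov property in expectation: the joint law of the history and the next step is a
composition product with `historyKernel`, which sees only the last step. -/
lemma integral_playLaw_succ (s : S) (n : ℕ) (f : Step S A B → ℝ) :
    ∫ ω, f (ω (n + 1)) ∂(G.playLaw x y s) =
      ∫ ω, (∫ r, f r ∂(G.nextLaw x y (ω n))) ∂(G.playLaw x y s) := by
  have h := Kernel.map_frestrictLe_trajMeasure_compProd_eq_map_trajMeasure
    (X := fun _ => Step S A B) (μ₀ := stepLaw x y s) (κ := G.historyKernel x y) (a := n)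
  change (G.playLaw x y s).map (Preorder.frestrictLe n) ⊗ₘ _ = (G.playLaw x y s).map _ at h
  obtain ⟨C, hC⟩ : ∃ C, ∀ q, ‖f q‖ ≤ C := by
    obtain ⟨C, hC⟩ := (Set.finite_range fun q => ‖f q‖).bddAbove
    exact ⟨C, fun q => hC ⟨q, rfl⟩⟩
  have hf : Measurable f := Measurable.of_discrete
  have hp : IsProbabilityMeasure ((G.playLaw x y s).map
      (Preorder.frestrictLe (π := fun _ => Step S A B) n)) :=
    Measure.isProbabilityMeasure_map (by fun_prop)
  have e1 : ∫ ω, f (ω (n + 1)) ∂(G.playLaw x y s) =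
      ∫ p, f p.2 ∂((G.playLaw x y s).map
        fun ω : ℕ → Step S A B => (Preorder.frestrictLe n ω, ω (n + 1))) := by
    refine (integral_map (φ := fun ω : ℕ → Step S A B => (Preorder.frestrictLe n ω, ω (n + 1)))
      (f := fun p => f p.2) ?_ (hf.comp measurable_snd).aestronglyMeasurable).symm
    exact ((Preorder.measurable_frestrictLe n).prodMk (measurable_pi_apply _)).aemeasurable
  rw [e1, ← h, Measure.integral_compProd]
  · have hm : Measurable fun q : Step S A B => ∫ r, f r ∂(G.nextLaw x y q) :=
      Measurable.of_discrete
    have hm' : Measurable fun h : (Π _ : Finset.Iic n, Step S A B) =>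
        ∫ r, f r ∂(G.nextLaw x y (h ⟨n, Finset.mem_Iic.2 le_rfl⟩)) :=
      hm.comp (measurable_pi_apply _)
    exact integral_map (by fun_prop) hm'.aestronglyMeasurable
  · exact Integrable.of_bound (hf.comp measurable_snd).aestronglyMeasurable C
      (Filter.Eventually.of_forall fun p => hC _)

/-- The expectation of `f` after one more step of play. -/
def stepOp (f : Step S A B → ℝ) (q : Step S A B) : ℝ := ∫ r, f r ∂(G.nextLaw x y q)

lemma integral_playLaw (s : S) (n : ℕ) (f : Step S A B → ℝ) :
    ∫ ω, f (ω n) ∂(G.playLaw x y s) = ∫ q, (G.stepOp x y)^[n] f q ∂(stepLaw x y s) := by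
  induction n generalizing f with
  | zero => exact G.integral_playLaw_zero x y s f
  | succ n ih =>
    rw [integral_playLaw_succ, Function.iterate_succ_apply]
    exact ih (G.stepOp x y f)

/-- The loss as a function of the step. -/
def stepLoss (q : Step S A B) : ℝ := G.loss q.state q.act₁ q.act₂

lemma γ_nonneg : 0 ≤ G.γ := by linarith [G.γ_mem.1]

lemma hasSum_value (s : S) :
    HasSum (fun n => G.γ ^ n * ∫ ω, G.stepLoss (ω n) ∂(G.playLaw x y s)) (G.value x y s) := by
  have hγ := G.γ_nonneg
  have hb : ∀ (n : ℕ) (ω : ℕ → Step S A B), ‖G.γ ^ n * G.stepLoss (ω n)‖ ≤ G.γ ^ n := by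
    intro n ω
    have := G.loss_mem (ω n).state (ω n).act₁ (ω n).act₂
    have h1 : 0 ≤ G.stepLoss (ω n) := this.1
    have h2 : G.stepLoss (ω n) ≤ 1 := this.2
    rw [Real.norm_eq_abs, abs_of_nonneg (mul_nonneg (pow_nonneg hγ n) h1)]
    exact mul_le_of_le_one_right (pow_nonneg hγ n) h2
  have hs : Summable fun n => G.γ ^ n := summable_geometric_of_lt_one hγ G.γ_mem.2
  have h := hasSum_integral_of_dominated_convergence (μ := G.playLaw x y s)
    (F := fun n ω => G.γ ^ n * G.stepLoss (ω n))
    (f := fun ω => ∑' n, G.γ ^ n * G.stepLoss (ω n))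
    (bound := fun n _ => G.γ ^ n)
    (fun n => ((Measurable.of_discrete (f := G.stepLoss)).comp
      (measurable_pi_apply n)).const_mul _ |>.aestronglyMeasurable)
    (fun n => Filter.Eventually.of_forall (hb n))
    (Filter.Eventually.of_forall fun _ => hs)
    (integrable_const _)
    (Filter.Eventually.of_forall fun ω =>
      (Summable.of_norm_bounded hs fun n => hb n ω).hasSum)
  simp_rw [integral_const_mul] at h
  exact h

/-- The Bellman equation for the value of a pair of stationary policies. -/
theorem value_eq (s : S) :
    G.value x y s =
      (x s).1.ofLp ⬝ᵥ (G.qMatrix (G.value x y) s *ᵥ (y s).1.ofLp) := by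
  -- `integral_playLaw_succ` peels off the last transition, whereas the Bellman equation needs the
  -- first. In the iterate of `stepOp` the first transition is the outermost factor, hence
  -- `Function.iterate_succ_apply'`.
  have hstep : ∀ n, ∫ ω, G.stepLoss (ω (n + 1)) ∂(G.playLaw x y s) =
      ∑ a, ∑ b, (x s).1 a * (y s).1 b * ∑ s', (G.trans s a b).1 s' *
        ∫ ω, G.stepLoss (ω n) ∂(G.playLaw x y s') := by
    intro n
    rw [integral_playLaw, Function.iterate_succ_apply', integral_stepLaw]
    simp_rw [integral_playLaw, stepOp, integral_nextLaw]
  have h0 : ∫ ω, G.stepLoss (ω 0) ∂(G.playLaw x y s) =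
      ∑ a, ∑ b, (x s).1 a * (y s).1 b * G.loss s a b := by
    rw [integral_playLaw_zero, integral_stepLaw]; rfl
  have h1 : HasSum (fun n => G.γ ^ (n + 1) * ∫ ω, G.stepLoss (ω (n + 1)) ∂(G.playLaw x y s))
      (∑ a, ∑ b, (x s).1 a * (y s).1 b * ∑ s', (G.trans s a b).1 s' *
        (G.γ * G.value x y s')) := by
    have : (fun n => G.γ ^ (n + 1) * ∫ ω, G.stepLoss (ω (n + 1)) ∂(G.playLaw x y s)) =
        fun n => ∑ a, ∑ b, (x s).1 a * (y s).1 b * ∑ s', (G.trans s a b).1 s' *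
        (G.γ * (G.γ ^ n * ∫ ω, G.stepLoss (ω n) ∂(G.playLaw x y s'))) := by
      funext n
      rw [hstep]
      simp_rw [Finset.mul_sum]
      refine Finset.sum_congr rfl fun a _ => Finset.sum_congr rfl fun b _ =>
        Finset.sum_congr rfl fun s' _ => ?_
      ring
    rw [this]
    refine hasSum_sum fun a _ => hasSum_sum fun b _ => HasSum.mul_left _ ?_
    exact hasSum_sum fun s' _ => ((G.hasSum_value x y s').mul_left _).mul_left _
  have h2 := (hasSum_nat_add_iff' 1).2 (G.hasSum_value x y s)
  have h3 := h2.unique h1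
  simp only [Finset.sum_range_one, pow_zero, one_mul] at h3
  rw [h0, sub_eq_iff_eq_add] at h3
  rw [h3, ← Finset.sum_add_distrib]
  simp only [dotProduct, mulVec, qMatrix, Matrix.of_apply, Finset.mul_sum,
    ← Finset.sum_add_distrib]
  refine Finset.sum_congr rfl fun a _ => Finset.sum_congr rfl fun b _ => ?_
  simp only [mul_add, add_mul, Finset.mul_sum, Finset.sum_mul]
  rw [add_comm]
  refine congrArg₂ _ (by ring) (Finset.sum_congr rfl fun s' _ => by ring)

end MarkovGame

/-! ### Comparison principles and the Bellman optimality equation. -/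

lemma dotProduct_le_of_mem_simplex {v : EuclideanSpace ℝ A} (hv : v ∈ simplex A) {f g : A → ℝ}
    {c : ℝ} (h : ∀ a, f a ≤ g a + c) : v.ofLp ⬝ᵥ f ≤ v.ofLp ⬝ᵥ g + c := by
  have : v.ofLp ⬝ᵥ g + c = ∑ a, v.ofLp a * (g a + c) := by
    simp only [mul_add, Finset.sum_add_distrib, ← Finset.sum_mul, hv.2, one_mul, dotProduct]
  rw [this]
  exact Finset.sum_le_sum fun a _ => mul_le_mul_of_nonneg_left (h a) (hv.1 a)

lemma dotProduct_le_const {v : EuclideanSpace ℝ A} (hv : v ∈ simplex A) {f : A → ℝ}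
    {c : ℝ} (h : ∀ a, f a ≤ c) : v.ofLp ⬝ᵥ f ≤ c := by
  simpa using dotProduct_le_of_mem_simplex hv (f := f) (g := 0) (c := c) (by simpa using h)

lemma const_le_dotProduct {v : EuclideanSpace ℝ A} (hv : v ∈ simplex A) {f : A → ℝ}
    {c : ℝ} (h : ∀ a, c ≤ f a) : c ≤ v.ofLp ⬝ᵥ f := by
  have := dotProduct_le_of_mem_simplex hv (f := 0) (g := f) (c := -c)
    (fun a => by have := h a; simp only [Pi.zero_apply]; linarith)
  simp only [dotProduct_zero] at this
  linarith

lemma nonempty_of_mem_simplex {v : EuclideanSpace ℝ A} (hv : v ∈ simplex A) : Nonempty A := by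
  by_contra h
  rw [not_nonempty_iff] at h
  have := hv.2
  simp at this

/-- Discounted comparison principle: if every upper bound `M` of `D` can be improved to
`γ M + g`, then `D` is bounded by `g / (1 - γ)`. -/
lemma le_div_of_forall_bound {γ g : ℝ} (hγ : γ < 1) {D : S → ℝ}
    (h : ∀ M, (∀ s, D s ≤ M) → ∀ s, D s ≤ γ * M + g) (s : S) : D s ≤ g / (1 - γ) := by
  have : Nonempty S := ⟨s⟩
  obtain ⟨s₀, hs₀⟩ := Finite.exists_max D
  have h1 := h (D s₀) hs₀ s₀
  refine (hs₀ s).trans ?_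
  rw [le_div_iff₀ (by linarith)]
  linarith

namespace MarkovGame

variable (G : MarkovGame S A B) (y : Policy S B)

/-- Expected state-action losses against `y` when the continuation values are `V`. -/
def qFun (V : S → ℝ) (s : S) : A → ℝ := G.qMatrix V s *ᵥ (y s).1.ofLp

lemma qFun_apply (V : S → ℝ) (s : S) (a : A) : G.qFun y V s a =
    (y s).1.ofLp ⬝ᵥ (fun b => G.loss s a b + G.γ * ((G.trans s a b).1.ofLp ⬝ᵥ V)) := by
  simp only [qFun, mulVec, qMatrix, Matrix.of_apply, dotProduct]
  exact Finset.sum_congr rfl fun b _ => mul_comm _ _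

lemma qFun_le_qFun_add {V W : S → ℝ} {M : ℝ} (h : ∀ s, V s ≤ W s + M) (s : S) (a : A) :
    G.qFun y V s a ≤ G.qFun y W s a + G.γ * M := by
  rw [qFun_apply, qFun_apply]
  refine dotProduct_le_of_mem_simplex (y s).2 fun b => ?_
  have h1 := dotProduct_le_of_mem_simplex (G.trans s a b).2 h
  have := mul_le_mul_of_nonneg_left h1 G.γ_nonneg
  linarith

lemma qFun_zero_nonneg (s : S) (a : A) : 0 ≤ G.qFun y 0 s a := by
  rw [qFun_apply]
  exact const_le_dotProduct (y s).2 fun b => by simpa using (G.loss_mem s a b).1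

lemma qFun_zero_le (s : S) (a : A) : G.qFun y 0 s a ≤ 1 := by
  rw [qFun_apply]
  exact dotProduct_le_const (y s).2 fun b => by simpa using (G.loss_mem s a b).2

lemma value_eq_dotProduct (x : Policy S A) (s : S) :
    G.value x y s = (x s).1.ofLp ⬝ᵥ G.qFun y (G.value x y) s := G.value_eq x y s

lemma one_sub_γ_pos : 0 < 1 - G.γ := by linarith [G.γ_mem.2]

lemma value_nonneg (x : Policy S A) (s : S) : 0 ≤ G.value x y s := by
  have := le_div_of_forall_bound (g := 0) G.γ_mem.2 (D := fun s => - G.value x y s)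
    (fun M hM s => by
      rw [G.value_eq_dotProduct]
      have h1 := const_le_dotProduct (x s).2 (f := G.qFun y (G.value x y) s) (c := - (G.γ * M))
        (fun a => by
          have := G.qFun_le_qFun_add y (V := 0) (W := G.value x y) (M := M)
            (fun s => by have := hM s; simp only [Pi.zero_apply]; linarith) s a
          have := G.qFun_zero_nonneg y s a
          linarith)
      linarith) s
  simp only [zero_div] at this
  linarith

lemma value_le (x : Policy S A) (s : S) : G.value x y s ≤ 1 / (1 - G.γ) :=
  le_div_of_forall_bound G.γ_mem.2 (D := fun s => G.value x y s)
    (fun M hM s => by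
      rw [G.value_eq_dotProduct]
      exact dotProduct_le_const (x s).2 fun a => by
        have := G.qFun_le_qFun_add y (V := G.value x y) (W := 0) (M := M)
          (fun s => by have := hM s; simp only [Pi.zero_apply]; linarith) s a
        have := G.qFun_zero_le y s a
        linarith) s

/-- A policy is suboptimal by at most its largest one-step suboptimality over `1 - γ`. -/
lemma value_sub_le {V : S → ℝ} {x : Policy S A} {g : ℝ}
    (h : ∀ s, (x s).1.ofLp ⬝ᵥ G.qFun y V s ≤ V s + g) (s : S) :
    G.value x y s - V s ≤ g / (1 - G.γ) :=
  le_div_of_forall_bound G.γ_mem.2 (D := fun s => G.value x y s - V s)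
    (fun M hM s => by
      have h1 := dotProduct_le_of_mem_simplex (x s).2
        (G.qFun_le_qFun_add y (V := G.value x y) (W := V) (M := M)
          (fun s => by linarith [hM s]) s)
      rw [G.value_eq_dotProduct]
      linarith [h s]) s

lemma le_value {V : S → ℝ} (h : ∀ s a, V s ≤ G.qFun y V s a) (x : Policy S A) (s : S) :
    V s ≤ G.value x y s := by
  have := le_div_of_forall_bound (g := 0) G.γ_mem.2 (D := fun s => V s - G.value x y s)
    (fun M hM s => by
      have h1 := dotProduct_le_of_mem_simplex (x s).2
        (G.qFun_le_qFun_add y (V := V) (W := G.value x y) (M := M)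
          (fun s => by linarith [hM s]) s)
      have h2 := const_le_dotProduct (x s).2 (h s)
      rw [G.value_eq_dotProduct]
      linarith) s
  simp only [zero_div] at this
  linarith

/-- The Bellman optimality equation has a solution. -/
lemma exists_optimal_value [Nonempty A] : ∃ V : S → ℝ,
    (∀ s a, V s ≤ G.qFun y V s a) ∧ ∀ s, ∃ a, G.qFun y V s a = V s := by
  let Φ : (S → ℝ) → S → ℝ := fun V s =>
    Finset.univ.inf' Finset.univ_nonempty (G.qFun y V s)
  have key : ∀ V W : S → ℝ, ∀ s, Φ V s - Φ W s ≤ G.γ * dist V W := by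
    intro V W s
    obtain ⟨a, -, ha⟩ := Finset.exists_mem_eq_inf' Finset.univ_nonempty (G.qFun y W s)
    have h1 : Φ V s ≤ G.qFun y V s a := Finset.inf'_le _ (Finset.mem_univ a)
    have h2 := G.qFun_le_qFun_add y (V := V) (W := W) (M := dist V W)
      (fun s => by
        have := (abs_le.1 ((Real.dist_eq (V s) (W s)).symm.le.trans (dist_le_pi_dist V W s))).2
        linarith) s a
    have h3 : Φ W s = G.qFun y W s a := ha
    linarith
  -- The optimality operator is a `γ`-contraction in the sup norm, so Banach's theorem supplies the
  -- optimal value.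
  have hc : ContractingWith ⟨G.γ, G.γ_nonneg⟩ Φ := by
    refine ⟨by exact_mod_cast G.γ_mem.2, LipschitzWith.of_dist_le_mul fun V W => ?_⟩
    change dist (Φ V) (Φ W) ≤ G.γ * dist V W
    refine (dist_pi_le_iff (mul_nonneg G.γ_nonneg dist_nonneg)).2 fun s => ?_
    rw [Real.dist_eq, abs_le]
    have h1 := key V W s
    have h2 := key W V s
    rw [dist_comm] at h2
    constructor <;> linarith
  have hfix : Φ (hc.fixedPoint Φ) = hc.fixedPoint Φ := hc.fixedPoint_isFixedPt
  refine ⟨hc.fixedPoint Φ, fun s a => ?_, fun s => ?_⟩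
  · conv_lhs => rw [← hfix]
    exact Finset.inf'_le _ (Finset.mem_univ a)
  · obtain ⟨a, -, ha⟩ := Finset.exists_mem_eq_inf' Finset.univ_nonempty
      (G.qFun y (hc.fixedPoint Φ) s)
    exact ⟨a, ha.symm.trans (congrFun hfix s)⟩

/-- The vertex of the simplex at `a`. -/
def vertex [DecidableEq A] (a : A) : simplex A :=
  ⟨EuclideanSpace.single a 1, by
    simpa [simplex, EuclideanSpace.single] using single_mem_stdSimplex ℝ a⟩

lemma vertex_dotProduct [DecidableEq A] (a : A) (f : A → ℝ) :
    (vertex a).1.ofLp ⬝ᵥ f = f a := by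
  simp [vertex, EuclideanSpace.single]

/-- The pure policy greedy for the fixed point `V` has value at most `V` by `value_sub_le`, while
every policy has value at least `V` by `le_value`. So the infimum is attained and equals `V`. -/
lemma exists_bestValue_eq [Nonempty A] : ∃ x : Policy S A, ∀ s,
    G.value x y s = G.bestValue y s ∧
    (∀ a, G.bestValue y s ≤ G.qFun y (G.bestValue y) s a) ∧
    ∃ a, G.qFun y (G.bestValue y) s a = G.bestValue y s := by
  classical
  obtain ⟨V, hV, hV'⟩ := G.exists_optimal_value y
  choose a ha using hV'
  let x : Policy S A := fun s => vertex (a s)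
  have hx : ∀ s, G.value x y s = V s := fun s =>
    le_antisymm (by
      have := G.value_sub_le y (V := V) (x := x) (g := 0)
        (fun s => by rw [vertex_dotProduct, ha, add_zero]) s
      simp only [zero_div] at this
      linarith) (G.le_value y hV x s)
  have hb : G.bestValue y = V := by
    funext s
    refine le_antisymm ?_ ?_
    · rw [← hx s]
      exact ciInf_le ⟨0, by rintro _ ⟨x', rfl⟩; exact G.value_nonneg y x' s⟩ x
    · have : Nonempty (Policy S A) := ⟨x⟩
      exact le_ciInf fun x' => G.le_value y hV x' s
  rw [hb]
  exact ⟨x, fun s => ⟨hx s, hV s, a s, ha s⟩⟩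

lemma bestValue_le_qFun (s : S) (a : A) : G.bestValue y s ≤ G.qFun y (G.bestValue y) s a := by
  have : Nonempty A := ⟨a⟩
  obtain ⟨x, hx⟩ := G.exists_bestValue_eq y
  exact (hx s).2.1 a

lemma bestValue_le_dotProduct {v : EuclideanSpace ℝ A} (hv : v ∈ simplex A) (s : S) :
    G.bestValue y s ≤ v.ofLp ⬝ᵥ G.qFun y (G.bestValue y) s :=
  const_le_dotProduct hv fun a => G.bestValue_le_qFun y s a

lemma bestValue_le_value (x : Policy S A) (s : S) : G.bestValue y s ≤ G.value x y s :=
  G.le_value y (fun s a => G.bestValue_le_qFun y s a) x s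

lemma bestValue_nonneg (s : S) : 0 ≤ G.bestValue y s :=
  Real.iInf_nonneg fun x => G.value_nonneg y x s

/-- Optimality decouples over states: a best response has value `bestValue`, so its Bellman equation
is the condition, and conversely zero one-step loss makes `value_sub_le` exact. -/
lemma mem_bestResponses_iff (x : Policy S A) : x ∈ G.bestResponses y ↔
    ∀ s, (x s).1.ofLp ⬝ᵥ G.qFun y (G.bestValue y) s = G.bestValue y s := by
  constructor
  · intro hx s
    have : Nonempty A := nonempty_of_mem_simplex (x s).2
    obtain ⟨x₀, hx₀⟩ := G.exists_bestValue_eq y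
    have h : G.value x y = G.bestValue y := by
      funext s
      refine le_antisymm ?_ (G.bestValue_le_value y x s)
      rw [← (hx₀ s).1]
      exact hx s x₀
    rw [← h, ← G.value_eq_dotProduct]
  · intro hx s x'
    have := G.value_sub_le y (V := G.bestValue y) (x := x) (g := 0)
      (fun s => by rw [hx, add_zero]) s
    simp only [zero_div] at this
    linarith [G.bestValue_le_value y x' s]

lemma exists_mem_bestResponses [Nonempty A] : (G.bestResponses y).Nonempty := by
  obtain ⟨x, hx⟩ := G.exists_bestValue_eq y
  exact ⟨x, fun s x' => (hx s).1.le.trans (G.bestValue_le_value y x' s)⟩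

/-- Replacing a best response at one state by another optimal distribution leaves it a best
response. Thus each `bestResponsesAt` is a face of the simplex, and statewise choices from these
faces assemble into a best response. -/
lemma mem_bestResponsesAt_iff (s : S) (v : EuclideanSpace ℝ A) : v ∈ G.bestResponsesAt y s ↔
    v ∈ simplex A ∧ v.ofLp ⬝ᵥ G.qFun y (G.bestValue y) s = G.bestValue y s := by
  classical
  constructor
  · rintro ⟨x, hx, rfl⟩
    exact ⟨(x s).2, (G.mem_bestResponses_iff y x).1 hx s⟩
  · rintro ⟨hv, h⟩
    have : Nonempty A := nonempty_of_mem_simplex hv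
    obtain ⟨x, hx⟩ := G.exists_mem_bestResponses y
    refine ⟨Function.update x s ⟨v, hv⟩, (G.mem_bestResponses_iff y _).2 fun s' => ?_, by simp⟩
    by_cases hs : s' = s
    · subst hs; simpa using h
    · rw [Function.update_of_ne hs]
      exact (G.mem_bestResponses_iff y x).1 hx s'

lemma bestValue_le (x : Policy S A) (s : S) : G.bestValue y s ≤ 1 / (1 - G.γ) :=
  (G.bestValue_le_value y x s).trans (G.value_le y x s)

end MarkovGame

/-! ### The optimal faces, the one-step gap and the error bound. -/

lemma convex_simplex : Convex ℝ (simplex A) := by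
  have := (convex_stdSimplex ℝ A).linear_preimage (WithLp.linearEquiv 2 ℝ (A → ℝ)).toLinearMap
  exact this

lemma isCompact_simplex : IsCompact (simplex A) :=
  (PiLp.homeomorph 2 (fun _ : A => ℝ)).isCompact_preimage.2 (isCompact_stdSimplex ℝ A)

namespace MarkovGame

variable (G : MarkovGame S A B) (y : Policy S B)

lemma continuous_dotProduct (f : A → ℝ) :
    Continuous fun v : EuclideanSpace ℝ A => v.ofLp ⬝ᵥ f := by
  unfold dotProduct
  fun_prop

lemma isCompact_bestResponsesAt (s : S) : IsCompact (G.bestResponsesAt y s) := by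
  have : G.bestResponsesAt y s = simplex A ∩
      {v | v.ofLp ⬝ᵥ G.qFun y (G.bestValue y) s = G.bestValue y s} := by
    ext v; exact G.mem_bestResponsesAt_iff y s v
  rw [this]
  exact isCompact_simplex.inter_right
    (isClosed_eq (continuous_dotProduct _) continuous_const)

lemma convex_bestResponsesAt (s : S) : Convex ℝ (G.bestResponsesAt y s) := by
  intro v hv w hw a b ha hb hab
  rw [mem_bestResponsesAt_iff] at hv hw ⊢
  refine ⟨convex_simplex hv.1 hw.1 ha hb hab, ?_⟩
  simp only [WithLp.ofLp_add, WithLp.ofLp_smul, add_dotProduct, smul_dotProduct, hv.2, hw.2,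
    smul_eq_mul]
  rw [← add_mul, hab, one_mul]

lemma bestResponsesAt_nonempty [Nonempty A] (s : S) : (G.bestResponsesAt y s).Nonempty := by
  obtain ⟨x, hx⟩ := G.exists_mem_bestResponses y
  exact ⟨(x s).1, x, hx, rfl⟩

/-- The one-step suboptimality of `v` at `s`, measured with the best-response values. -/
def gap (s : S) (v : EuclideanSpace ℝ A) : ℝ :=
  v.ofLp ⬝ᵥ G.qFun y (G.bestValue y) s - G.bestValue y s

lemma gap_nonneg {v : EuclideanSpace ℝ A} (hv : v ∈ simplex A) (s : S) : 0 ≤ G.gap y s v :=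
  sub_nonneg.2 (G.bestValue_le_dotProduct y hv s)

lemma gap_eq_sum {v : EuclideanSpace ℝ A} (hv : v ∈ simplex A) (s : S) :
    G.gap y s v = ∑ a, v.ofLp a * (G.qFun y (G.bestValue y) s a - G.bestValue y s) := by
  simp only [gap, dotProduct, mul_sub, Finset.sum_sub_distrib, ← Finset.sum_mul, hv.2, one_mul]

lemma iSup_sub_dotProduct (s : S) (v : simplex A) :
    (⨆ v' : simplex A,
        (v.1.ofLp ⬝ᵥ (G.qMatrix (G.bestValue y) s *ᵥ (y s).1.ofLp) -
          v'.1.ofLp ⬝ᵥ (G.qMatrix (G.bestValue y) s *ᵥ (y s).1.ofLp))) = G.gap y s v.1 := by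
  have : Nonempty (simplex A) := ⟨v⟩
  have : Nonempty A := nonempty_of_mem_simplex v.2
  obtain ⟨w, hw⟩ := G.bestResponsesAt_nonempty y s
  rw [mem_bestResponsesAt_iff] at hw
  have hle : ∀ v' : simplex A, v.1.ofLp ⬝ᵥ (G.qMatrix (G.bestValue y) s *ᵥ (y s).1.ofLp) -
      v'.1.ofLp ⬝ᵥ (G.qMatrix (G.bestValue y) s *ᵥ (y s).1.ofLp) ≤ G.gap y s v.1 :=
    fun v' => sub_le_sub_left (G.bestValue_le_dotProduct y v'.2 s) _
  refine le_antisymm (ciSup_le hle) ?_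
  refine le_ciSup_of_le ⟨_, by rintro _ ⟨v', rfl⟩; exact hle v'⟩ ⟨w, hw.1⟩ ?_
  exact sub_le_sub_left hw.2.le _

lemma isErrorBoundConst_iff (C : ℝ) : G.IsErrorBoundConst y C ↔
    ∀ (s : S) (v : EuclideanSpace ℝ A), v ∈ simplex A →
      C * Metric.infDist v (G.bestResponsesAt y s) ≤ G.gap y s v := by
  unfold IsErrorBoundConst
  simp_rw [iSup_sub_dotProduct]
  exact ⟨fun h s v hv => h s ⟨v, hv⟩, fun h s v => h s v.1 v.2⟩

lemma exists_pos_le_qFun_sub : ∃ c : ℝ, 0 < c ∧ ∀ (s : S) (a : A),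
    G.qFun y (G.bestValue y) s a ≠ G.bestValue y s →
      c ≤ G.qFun y (G.bestValue y) s a - G.bestValue y s := by
  classical
  -- The dummy value `1` at optimal pairs keeps the minimum positive, even if every pair is optimal.
  let g : S × A → ℝ := fun p => if G.qFun y (G.bestValue y) p.1 p.2 = G.bestValue y p.1 then 1
    else G.qFun y (G.bestValue y) p.1 p.2 - G.bestValue y p.1
  rcases isEmpty_or_nonempty (S × A) with h | h
  · exact ⟨1, one_pos, fun s a => (h.false (s, a)).elim⟩
  · obtain ⟨p, hp⟩ := Finite.exists_min g
    refine ⟨g p, ?_, fun s a hsa => ?_⟩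
    · by_cases h' : G.qFun y (G.bestValue y) p.1 p.2 = G.bestValue y p.1
      · simp [g, h']
      · simp only [g, if_neg h']
        exact sub_pos.2 (lt_of_le_of_ne (G.bestValue_le_qFun y p.1 p.2) (Ne.symm h'))
    · have := hp (s, a)
      simpa only [g, if_neg hsa] using this

lemma sum_smul_vertex [DecidableEq A] (v : EuclideanSpace ℝ A) :
    ∑ a, v.ofLp a • (vertex a).1 = v := by
  ext b
  simp [vertex, WithLp.ofLp_sum, Pi.single_apply]

lemma norm_vertex [DecidableEq A] (a : A) : ‖(vertex a).1‖ = 1 := by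
  simp [vertex]

/-- Moving the mass of suboptimal actions to an optimal action gives a linear error bound. -/
theorem exists_isErrorBoundConst : ∃ C : ℝ, 0 < C ∧ G.IsErrorBoundConst y C := by
  classical
  obtain ⟨c, hc, hgap⟩ := G.exists_pos_le_qFun_sub y
  refine ⟨c / 2, by positivity, (G.isErrorBoundConst_iff y _).2 fun s v hv => ?_⟩
  have : Nonempty A := nonempty_of_mem_simplex hv
  obtain ⟨_, hx⟩ := G.exists_bestValue_eq y
  obtain ⟨-, -, a₀, ha₀⟩ := hx s
  let f : A → A := fun a => if G.qFun y (G.bestValue y) s a = G.bestValue y s then a else a₀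
  have hf : ∀ a, (vertex (f a)).1 ∈ G.bestResponsesAt y s := by
    intro a
    rw [mem_bestResponsesAt_iff, vertex_dotProduct]
    refine ⟨(vertex (f a)).2, ?_⟩
    by_cases h : G.qFun y (G.bestValue y) s a = G.bestValue y s
    · simp [f, h]
    · simpa [f, h] using ha₀
  have hw : ∑ a, v.ofLp a • (vertex (f a)).1 ∈ G.bestResponsesAt y s :=
    (G.convex_bestResponsesAt y s).sum_mem (fun a _ => hv.1 a) hv.2 fun a _ => hf a
  -- Moving a unit of mass between vertices costs distance at most `2`, and each unit on a
  -- suboptimal action contributes at least `c` to the gap.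
  have hd : ‖v - ∑ a, v.ofLp a • (vertex (f a)).1‖ ≤ 2 / c * G.gap y s v := by
    rw [gap_eq_sum G y hv, Finset.mul_sum]
    nth_rewrite 1 [← sum_smul_vertex v]
    rw [← Finset.sum_sub_distrib]
    refine (norm_sum_le _ _).trans (Finset.sum_le_sum fun a _ => ?_)
    rw [← smul_sub, norm_smul, Real.norm_of_nonneg (hv.1 a), mul_left_comm]
    refine mul_le_mul_of_nonneg_left ?_ (hv.1 a)
    by_cases h : G.qFun y (G.bestValue y) s a = G.bestValue y s
    · simp [f, h]
    · have h1 := hgap s a h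
      calc ‖(vertex a).1 - (vertex (f a)).1‖ ≤ 1 + 1 := by
            refine (norm_sub_le _ _).trans ?_
            rw [norm_vertex, norm_vertex]
        _ = 2 / c * c := by field_simp; norm_num
        _ ≤ _ := mul_le_mul_of_nonneg_left h1 (by positivity)
  have hi := Metric.infDist_le_dist_of_mem hw (x := v)
  rw [dist_eq_norm] at hi
  calc c / 2 * Metric.infDist v (G.bestResponsesAt y s)
      ≤ c / 2 * (2 / c * G.gap y s v) := mul_le_mul_of_nonneg_left (hi.trans hd) (by positivity)
    _ = G.gap y s v := by field_simp

lemma qFun_bestValue_le (x : Policy S A) (s : S) (a : A) :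
    G.qFun y (G.bestValue y) s a ≤ 1 / (1 - G.γ) := by
  have h := G.qFun_le_qFun_add y (V := G.bestValue y) (W := 0) (M := 1 / (1 - G.γ))
    (fun s => by simpa using G.bestValue_le y x s) s a
  have h1 := G.qFun_zero_le y s a
  have h2 : 1 + G.γ * (1 / (1 - G.γ)) = 1 / (1 - G.γ) := by
    have := G.one_sub_γ_pos.ne'
    field_simp
    ring
  linarith

lemma gap_le (x : Policy S A) {v : EuclideanSpace ℝ A} (hv : v ∈ simplex A) (s : S) :
    G.gap y s v ≤ 1 / (1 - G.γ) := by
  have := dotProduct_le_const hv (G.qFun_bestValue_le y x s)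
  have := G.bestValue_nonneg y s
  unfold gap
  linarith

/-- An error-bound constant is at most `1 / (1 - γ)` unless every action is optimal. -/
lemma mem_bestResponsesAt_or_le {C : ℝ} (hC : G.IsErrorBoundConst y C) (hC0 : 0 < C)
    (x : Policy S A) (s : S) :
    (x s).1 ∈ G.bestResponsesAt y s ∨ C ≤ 1 / (1 - G.γ) := by
  classical
  rw [or_iff_not_imp_left]
  intro hx
  rw [mem_bestResponsesAt_iff] at hx
  obtain ⟨a, ha⟩ : ∃ a, G.qFun y (G.bestValue y) s a ≠ G.bestValue y s := by
    by_contra! h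
    have h0 : G.gap y s (x s).1 = 0 := by
      rw [gap_eq_sum G y (x s).2]
      exact Finset.sum_eq_zero fun a _ => by rw [h a, sub_self, mul_zero]
    exact hx ⟨(x s).2, sub_eq_zero.1 h0⟩
  have hpos : 0 < G.qFun y (G.bestValue y) s a - G.bestValue y s :=
    sub_pos.2 (lt_of_le_of_ne (G.bestValue_le_qFun y s a) (Ne.symm ha))
  have : Nonempty A := ⟨a⟩
  -- A point of the optimal face has no mass on the suboptimal `a`, so coordinate `a` alone
  -- separates it from the vertex by `1`. The gap at the vertex is at most `1 / (1 - γ)`, which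
  -- bounds `C`.
  have hd : 1 ≤ Metric.infDist (vertex a).1 (G.bestResponsesAt y s) := by
    refine (Metric.le_infDist (G.bestResponsesAt_nonempty y s)).2 fun w hw => ?_
    rw [mem_bestResponsesAt_iff] at hw
    have h0 : G.gap y s w = 0 := sub_eq_zero.2 hw.2
    rw [gap_eq_sum G y hw.1] at h0
    have h1 := (Finset.sum_eq_zero_iff_of_nonneg fun b _ => mul_nonneg (hw.1.1 b)
      (sub_nonneg.2 (G.bestValue_le_qFun y s b))).1 h0 a (Finset.mem_univ a)
    have h2 : w.ofLp a = 0 := (mul_eq_zero.1 h1).resolve_right hpos.ne'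
    rw [dist_eq_norm]
    refine le_trans ?_ (PiLp.norm_apply_le _ a)
    simp [vertex, h2]
  have h1 := (G.isErrorBoundConst_iff y C).1 hC s _ (vertex a).2
  have h2 := G.gap_le y x (vertex a).2 s
  nlinarith

end MarkovGame

/-! ### Geometry of the simplex and of projected steps. -/

lemma norm_sub_sq_le_two {v w : EuclideanSpace ℝ A} (hv : v ∈ simplex A) (hw : w ∈ simplex A) :
    ‖v - w‖ ^ 2 ≤ 2 := by
  rw [EuclideanSpace.norm_sq_eq]
  have h1 : ∀ u ∈ simplex A, ∀ a, u.ofLp a ≤ 1 := fun u hu a => by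
    rw [← hu.2]
    exact Finset.single_le_sum (fun b _ => hu.1 b) (Finset.mem_univ a)
  calc ∑ a, ‖(v - w).ofLp a‖ ^ 2 ≤ ∑ a, (v.ofLp a + w.ofLp a) := by
        refine Finset.sum_le_sum fun a _ => ?_
        rw [WithLp.ofLp_sub, Pi.sub_apply, Real.norm_eq_abs, sq_abs]
        have := h1 v hv a
        have := h1 w hw a
        have := hv.1 a
        have := hw.1 a
        nlinarith [mul_nonneg (hv.1 a) (hw.1 a)]
    _ = 2 := by rw [Finset.sum_add_distrib, hv.2, hw.2]; norm_num

lemma norm_sub_le_two {v w : EuclideanSpace ℝ A} (hv : v ∈ simplex A) (hw : w ∈ simplex A) :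
    ‖v - w‖ ≤ 2 := by
  nlinarith [norm_sub_sq_le_two hv hw, norm_nonneg (v - w)]

lemma inner_toLp (v : EuclideanSpace ℝ A) (f : A → ℝ) :
    inner ℝ v (WithLp.toLp 2 f) = v.ofLp ⬝ᵥ f := by
  rw [EuclideanSpace.inner_eq_star_dotProduct]
  simp [dotProduct_comm]

/-- The three-point inequality for one projected gradient step. -/
lemma IsProj.two_mul_inner_le {E : Type*} [NormedAddCommGroup E] [InnerProductSpace ℝ E]
    {U : Set E} (hU : Convex ℝ U) {v l u w : E} {η : ℝ} (h : IsProj U (v - η • l) u)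
    (hw : w ∈ U) :
    2 * η * inner ℝ (u - w) l ≤ ‖v - w‖ ^ 2 - ‖u - w‖ ^ 2 - ‖u - v‖ ^ 2 := by
  -- The variational inequality characterising projections onto convex sets.
  have h1 : inner ℝ (v - η • l - u) (w - u) ≤ 0 := by
    refine (norm_eq_iInf_iff_real_inner_le_zero hU h.1).1 ?_ w hw
    have : Nonempty U := ⟨⟨u, h.1⟩⟩
    refine le_antisymm (le_ciInf fun z => ?_)
      (ciInf_le (f := fun z : U => ‖v - η • l - z‖) ⟨0, ?_⟩ ⟨u, h.1⟩)
    · rw [norm_sub_rev, norm_sub_rev _ (z : E)]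
      exact h.2 z z.2
    · rintro _ ⟨z, rfl⟩
      exact norm_nonneg _
  have h2 : ‖v - w‖ ^ 2 = ‖u - v‖ ^ 2 + ‖u - w‖ ^ 2 - 2 * inner ℝ (v - u) (w - u) := by
    rw [show v - w = (v - u) - (w - u) by abel, norm_sub_sq_real, norm_sub_rev v u,
      norm_sub_rev w u]
    ring
  have h3 : inner ℝ (v - η • l - u) (w - u) = inner ℝ (v - u) (w - u) + η * inner ℝ (u - w) l := by
    rw [show v - η • l - u = (v - u) - η • l by abel, inner_sub_left, inner_smul_left,
      real_inner_comm (w - u) l, show u - w = -(w - u) by abel, inner_neg_left]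
    simp [sub_eq_add_neg]
  rw [h3] at h1
  linarith

/-! ### Drift of the critic and one-step regret of the actor. -/

namespace MarkovGame

variable {G : MarkovGame S A B} {y : Policy S B}

lemma rate_pos (t : ℕ) : 0 < G.rate t := by
  have := G.one_sub_γ_pos
  unfold rate
  positivity

lemma rate_le_one {t : ℕ} (ht : 1 ≤ t) : G.rate t ≤ 1 := by
  have := G.one_sub_γ_pos
  have : (1 : ℝ) ≤ t := by exact_mod_cast ht
  unfold rate
  rw [div_le_one (by positivity)]
  linarith

/-- How much the weights of the critic grow from one step to the next. -/
lemma rate_sub (t : ℕ) : G.rate (t + 1) - (1 - G.rate (t + 1)) * G.rate t =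
    G.rate (t + 1) * ((2 / (1 - G.γ)) / (2 / (1 - G.γ) + t)) := by
  have := G.one_sub_γ_pos
  have hH : 0 < 2 / (1 - G.γ) := by positivity
  unfold rate
  set H := 2 / (1 - G.γ)
  have h1 : H + t ≠ 0 := by positivity
  have h2 : H + (t + 1 : ℝ) ≠ 0 := by positivity
  push_cast
  field_simp
  ring

namespace SinglePlayerRun

variable {η ε : ℝ} {T : ℕ}

/-- With no states the division by `0` would give `0`, and the step-size bound would force `η ≤ 0`.
-/
lemma card_pos (R : G.SinglePlayerRun y η ε T) : 0 < Fintype.card S := by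
  by_contra h
  have h0 : Fintype.card S = 0 := by omega
  have := R.η_le
  rw [h0] at this
  simp at this
  linarith [R.η_pos]

lemma η_le_sq (R : G.SinglePlayerRun y η ε T) : η ≤ 1 / 10 ^ 4 * (1 - G.γ) ^ 2 := by
  have hd := G.one_sub_γ_pos
  have hc : (1 : ℝ) ≤ Fintype.card S := by exact_mod_cast R.card_pos
  refine R.η_le.trans (mul_le_mul_of_nonneg_left ?_ (by norm_num))
  refine Real.sqrt_le_iff.2 ⟨by positivity, ?_⟩
  calc (1 - G.γ) ^ 5 / (Fintype.card S : ℝ) ≤ (1 - G.γ) ^ 5 := div_le_self (by positivity) hc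
    _ ≤ ((1 - G.γ) ^ 2) ^ 2 := by
      rw [← pow_mul]
      exact pow_le_pow_of_le_one hd.le (by linarith [G.γ_nonneg]) (by norm_num)

variable (R : G.SinglePlayerRun y η ε T)

lemma abs_inner_sub_le {t : ℕ} (ht : t ∈ Finset.Icc 1 T) (s : S) {v w : EuclideanSpace ℝ A}
    (hv : v ∈ simplex A) (hw : w ∈ simplex A) :
    |inner ℝ (v - w) (R.l t s) - (v.ofLp ⬝ᵥ G.qFun y (R.V (t - 1)) s -
      w.ofLp ⬝ᵥ G.qFun y (R.V (t - 1)) s)| ≤ 2 * ε := by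
  have h1 := R.l_approx t ht s
  rw [← inner_toLp, ← inner_toLp, ← inner_sub_left, ← inner_sub_right]
  exact (abs_real_inner_le_norm _ _).trans
    (mul_le_mul (norm_sub_le_two hv hw) h1 (norm_nonneg _) (by norm_num))

lemma V_succ {t : ℕ} (ht : t + 1 ≤ T) (s : S) :
    R.V (t + 1) s = (1 - G.rate (t + 1)) * R.V t s + G.rate (t + 1) * R.ρ (t + 1) s :=
  R.V_update (t + 1) (by simp [ht]) s

lemma abs_ρ_sub_le {t : ℕ} (ht : t + 1 ≤ T) (s : S) :
    |R.ρ (t + 1) s - (R.x (t + 1) s).1.ofLp ⬝ᵥ G.qFun y (R.V t) s| ≤ ε :=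
  R.ρ_approx (t + 1) (by simp [ht]) s

/-- The endpoints are the fixed points of `M ↦ 1 + γ M + ε` and `M ↦ γ M - ε`, so the interval is
invariant under an `ε`-inexact Bellman update. -/
lemma ρ_mem_Icc {t : ℕ} (ht : t + 1 ≤ T)
    (hV : ∀ s, R.V t s ∈ Set.Icc (-(ε / (1 - G.γ))) ((1 + ε) / (1 - G.γ))) (s : S) :
    R.ρ (t + 1) s ∈ Set.Icc (-(ε / (1 - G.γ))) ((1 + ε) / (1 - G.γ)) := by
  have hd := G.one_sub_γ_pos
  have hρ := abs_le.1 (R.abs_ρ_sub_le ht s)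
  have h1 := dotProduct_le_const (R.x (t + 1) s).2 (f := G.qFun y (R.V t) s)
    (c := 1 + G.γ * ((1 + ε) / (1 - G.γ))) (fun a => by
      have := G.qFun_le_qFun_add y (V := R.V t) (W := 0)
        (fun s => by simpa using (hV s).2) s a
      linarith [G.qFun_zero_le y s a])
  have h2 := const_le_dotProduct (R.x (t + 1) s).2 (f := G.qFun y (R.V t) s)
    (c := -(G.γ * (ε / (1 - G.γ)))) (fun a => by
      have := G.qFun_le_qFun_add y (V := 0) (W := R.V t) (M := ε / (1 - G.γ))
        (fun s => by have := (hV s).1; simp only [Pi.zero_apply]; linarith) s a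
      linarith [G.qFun_zero_nonneg y s a])
  have e1 : 1 + G.γ * ((1 + ε) / (1 - G.γ)) + ε = (1 + ε) / (1 - G.γ) := by
    field_simp; ring
  have e2 : G.γ * (ε / (1 - G.γ)) + ε = ε / (1 - G.γ) := by field_simp; ring
  exact ⟨by linarith [hρ.1], by linarith [hρ.2]⟩

lemma V_mem_Icc {t : ℕ} (ht : t ≤ T) (s : S) :
    R.V t s ∈ Set.Icc (-(ε / (1 - G.γ))) ((1 + ε) / (1 - G.γ)) := by
  have hd := G.one_sub_γ_pos
  have hε := R.ε_nonneg
  induction t generalizing s with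
  | zero =>
    rw [R.V_init]
    exact ⟨by rw [neg_nonpos]; positivity, by positivity⟩
  | succ t ih =>
    have hV := fun s => ih (by omega) s
    have hρ := R.ρ_mem_Icc ht hV s
    rw [R.V_succ ht]
    refine convex_Icc _ _ (hV s) hρ (sub_nonneg.2 (rate_le_one (by omega)))
      (rate_pos _).le (by ring)

lemma abs_V_succ_sub_le {t : ℕ} (ht : t + 1 ≤ T) (s : S) :
    |R.V (t + 1) s - R.V t s| ≤ G.rate (t + 1) * (3 / (1 - G.γ) ^ 2) := by
  have hd := G.one_sub_γ_pos
  have hV := fun s => R.V_mem_Icc (t := t) (by omega) s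
  have hρ := R.ρ_mem_Icc ht hV s
  have h1 : R.V (t + 1) s - R.V t s = G.rate (t + 1) * (R.ρ (t + 1) s - R.V t s) := by
    rw [R.V_succ ht]; ring
  rw [h1, abs_mul, abs_of_pos (rate_pos _)]
  refine mul_le_mul_of_nonneg_left ?_ (rate_pos _).le
  have h2 : (1 + ε) / (1 - G.γ) + ε / (1 - G.γ) ≤ 3 / (1 - G.γ) ^ 2 := by
    rw [← add_div, div_le_div_iff₀ hd (by positivity)]
    have := R.ε_le
    rw [le_div_iff₀ hd] at this
    have : (1 - G.γ) ≤ 1 := by linarith [G.γ_nonneg]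
    nlinarith
  rw [abs_le]
  constructor <;> linarith [hρ.1, hρ.2, (hV s).1, (hV s).2]

/-- Successive loss vectors differ little, so the optimistic step costs little. -/
lemma optimism_error_le {t : ℕ} (ht : t + 1 ≤ T) (s : S) {w : EuclideanSpace ℝ A}
    (hw : w ∈ simplex A) :
    2 * η * ((R.x (t + 1) s).1.ofLp ⬝ᵥ G.qFun y (R.V t) s - w.ofLp ⬝ᵥ G.qFun y (R.V t) s) ≤
      ‖(R.xhat (t + 1) s).1 - w‖ ^ 2 - ‖(R.xhat (t + 2) s).1 - w‖ ^ 2 +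
        2 * η * (6 * ε + 6 / (1 - G.γ) ^ 2 * G.rate t) := by
  have hd := G.one_sub_γ_pos
  have hη := R.η_pos
  have hε := R.ε_nonneg
  have hmem : t + 1 ∈ Finset.Icc 1 T := by simp [ht]
  set xt := R.x (t + 1) s
  set u := R.xhat (t + 2) s
  set v := R.xhat (t + 1) s with hv
  have hu : 2 * η * inner ℝ (u.1 - w) (R.l (t + 1) s) ≤
      ‖v.1 - w‖ ^ 2 - ‖u.1 - w‖ ^ 2 - ‖u.1 - v.1‖ ^ 2 :=
    (R.xhat_update (t + 1) hmem s).two_mul_inner_le convex_simplex hw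
  have hlw := abs_le.1 (R.abs_inner_sub_le hmem s xt.2 hw)
  have hlu := abs_le.1 (R.abs_inner_sub_le hmem s xt.2 u.2)
  rw [Nat.add_sub_cancel] at hlw hlu
  have hsplit : inner ℝ (xt.1 - w) (R.l (t + 1) s) =
      inner ℝ (xt.1 - u.1) (R.l (t + 1) s) + inner ℝ (u.1 - w) (R.l (t + 1) s) := by
    rw [← inner_add_left]; congr 1; abel
  have hvar : 2 * η * inner ℝ (xt.1 - u.1) (R.l (t + 1) s) ≤
      ‖u.1 - v.1‖ ^ 2 + 2 * η * (4 * ε + 6 / (1 - G.γ) ^ 2 * G.rate t) := by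
    -- The first iteration has no earlier loss to predict from. There `V 0 = 0` keeps the losses in
    -- `[0, 1]`, and `rate 0 ≥ 1` makes the error term absorb them.
    rcases Nat.eq_zero_or_pos t with rfl | htpos
    · have hV0 : R.V 0 = 0 := funext R.V_init
      rw [hV0] at hlu
      have h1 := dotProduct_le_const xt.2 (G.qFun_zero_le y s)
      have h2 := const_le_dotProduct u.2 (G.qFun_zero_nonneg y s)
      have h3 : 1 ≤ 6 / (1 - G.γ) ^ 2 * G.rate 0 := by
        have : 1 ≤ G.rate 0 := by
          unfold rate
          rw [le_div_iff₀ (by positivity)]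
          simp
        have : 1 ≤ 6 / (1 - G.γ) ^ 2 := by
          rw [le_div_iff₀ (by positivity)]
          nlinarith [G.γ_nonneg]
        nlinarith
      have : inner ℝ (xt.1 - u.1) (R.l (0 + 1) s) ≤ 4 * ε + 6 / (1 - G.γ) ^ 2 * G.rate 0 := by
        linarith [hlu.2]
      nlinarith [sq_nonneg ‖u.1 - v.1‖]
    · obtain ⟨r, rfl⟩ : ∃ r, t = r + 1 := ⟨t - 1, by omega⟩
      have hmem' : r + 1 ∈ Finset.Icc 1 T := by simp; omega
      -- The optimistic step is compared with the next `xhat` iterate `u`. Its `‖v - u‖²` will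
      -- cancel against the negative term of `hu`.
      have hx : 2 * η * inner ℝ (xt.1 - u.1) (R.l (r + 1) s) ≤
          ‖v.1 - u.1‖ ^ 2 - ‖xt.1 - u.1‖ ^ 2 - ‖xt.1 - v.1‖ ^ 2 :=
        (R.x_update (r + 1) hmem' s).two_mul_inner_le convex_simplex u.2
      have hlu' := abs_le.1 (R.abs_inner_sub_le hmem' s xt.2 u.2)
      rw [Nat.add_sub_cancel] at hlu'
      set M := G.rate (r + 1) * (3 / (1 - G.γ) ^ 2) with hM
      have hVd := fun s => abs_le.1 (R.abs_V_succ_sub_le (t := r) (by omega) s)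
      have h1 := dotProduct_le_of_mem_simplex xt.2
        (G.qFun_le_qFun_add y (V := R.V (r + 1)) (W := R.V r) (M := M)
          (fun s => by linarith [(hVd s).2]) s)
      have h2 := dotProduct_le_of_mem_simplex u.2
        (G.qFun_le_qFun_add y (V := R.V r) (W := R.V (r + 1)) (M := M)
          (fun s => by linarith [(hVd s).1]) s)
      have hM0 : 0 ≤ M := mul_nonneg (rate_pos _).le (by positivity)
      have h3 : G.γ * M ≤ M := mul_le_of_le_one_left hM0 G.γ_mem.2.le
      -- Passing from the new loss estimate to the old one costs `2ε` for each estimate and `2M` for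
      -- the drift of the critic.
      have h4 : inner ℝ (xt.1 - u.1) (R.l (r + 1 + 1) s) ≤
          inner ℝ (xt.1 - u.1) (R.l (r + 1) s) +
            (4 * ε + 6 / (1 - G.γ) ^ 2 * G.rate (r + 1)) := by
        have : 6 / (1 - G.γ) ^ 2 * G.rate (r + 1) = 2 * M := by rw [hM]; ring
        linarith [hlu.2, hlu'.1]
      have h5 := mul_le_mul_of_nonneg_left h4 (by positivity : 0 ≤ 2 * η)
      rw [norm_sub_rev v.1 u.1] at hx
      nlinarith [sq_nonneg ‖xt.1 - u.1‖, sq_nonneg ‖xt.1 - v.1‖]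
  have h6 := mul_le_mul_of_nonneg_left
    (show (xt.1.ofLp ⬝ᵥ G.qFun y (R.V t) s - w.ofLp ⬝ᵥ G.qFun y (R.V t) s) ≤
      inner ℝ (xt.1 - u.1) (R.l (t + 1) s) + inner ℝ (u.1 - w) (R.l (t + 1) s) + 2 * ε by
      linarith [hlw.1]) (by positivity : 0 ≤ 2 * η)
  linarith

end SinglePlayerRun
end MarkovGame

/-! ### Convergence of the critic to the best-response values. -/

namespace MarkovGame

variable {G : MarkovGame S A B} {y : Policy S B}

/-- The bound on the distance of the critic's values at time `t` from the best-response values. -/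
def criticBound (G : MarkovGame S A B) (η ε : ℝ) (t : ℕ) : ℝ :=
  2 * (2 / (1 - G.γ) + 1) ^ 2 / η / (2 / (1 - G.γ) + t) + 7 * ε / (1 - G.γ)

/-- The contraction per step is `rate (t + 1) * (1 - γ)`, about `(3 - γ) / t`. Since `3 - γ > 1`,
forcing of order `rate / t` yields a bound of order `1 / t`. The choice of `H` enters as `H (1 - γ)
= 2`. -/
lemma criticBound_succ {η : ℝ} (hη : 0 < η) (ε : ℝ) (t : ℕ) :
    (1 - G.rate (t + 1) * (1 - G.γ)) * G.criticBound η ε t + G.rate (t + 1) *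
      (2 * (2 / (1 - G.γ) + 1) / η / (2 / (1 - G.γ) + t) + 7 * ε) ≤
        G.criticBound η ε (t + 1) := by
  have hd := G.one_sub_γ_pos
  have hH : 0 < 2 / (1 - G.γ) := by positivity
  have hHd : 2 / (1 - G.γ) * (1 - G.γ) = 2 := by field_simp
  unfold criticBound rate
  set H := 2 / (1 - G.γ)
  set d := 1 - G.γ
  push_cast
  have h1 : 0 < H + t := by positivity
  have h2 : 0 < H + (t + 1) := by positivity
  have key : 2 * (H + 1) ^ 2 / η / (H + (t + 1)) + 7 * ε / d -
      ((1 - (H + 1) / (H + (t + 1)) * d) * (2 * (H + 1) ^ 2 / η / (H + t) + 7 * ε / d) +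
        (H + 1) / (H + (t + 1)) * (2 * (H + 1) / η / (H + t) + 7 * ε)) =
      2 * (H + 1) ^ 2 / η / (H + t) / (H + (t + 1)) * (H * d + d - 2) := by
    field_simp
    ring
  rw [← sub_nonneg, key, hHd]
  have : 0 ≤ 2 + d - 2 := by linarith
  positivity

lemma criticBound_le {η ε : ℝ} (hη : 0 < η) (t : ℕ) :
    G.criticBound η ε t ≤ 18 / (η * (1 - G.γ) ^ 2 * (t + 1)) + 7 * ε / (1 - G.γ) := by
  have hd := G.one_sub_γ_pos
  have hd1 : 1 - G.γ ≤ 1 := by linarith [G.γ_nonneg]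
  unfold criticBound
  refine add_le_add_left ?_ _
  have hH : 1 ≤ 2 / (1 - G.γ) := by rw [le_div_iff₀ hd]; linarith
  have h1 : 2 / (1 - G.γ) + 1 ≤ 3 / (1 - G.γ) := by
    rw [le_div_iff₀ hd, add_mul, div_mul_cancel₀ _ hd.ne']; linarith
  calc 2 * (2 / (1 - G.γ) + 1) ^ 2 / η / (2 / (1 - G.γ) + t)
      ≤ 2 * (3 / (1 - G.γ)) ^ 2 / η / (1 + t) := by gcongr
    _ = 18 / (η * (1 - G.γ) ^ 2 * (t + 1)) := by field_simp; ring

namespace SinglePlayerRun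

variable {η ε : ℝ} {T : ℕ} (R : G.SinglePlayerRun y η ε T)

lemma six_div_le (R : G.SinglePlayerRun y η ε T) : 6 / (1 - G.γ) ^ 2 ≤ 1 / η := by
  have hd := G.one_sub_γ_pos
  have hη := R.η_pos
  rw [div_le_div_iff₀ (by positivity) hη]
  have := R.η_le_sq
  nlinarith [sq_nonneg (1 - G.γ)]

/-- The critic's overestimation plus the weighted distance to a best response decreases. -/
lemma V_sub_bestValue_add_le {xs : Policy S A} (hxs : xs ∈ G.bestResponses y) {t : ℕ}
    (ht : t ≤ T) (s : S) :
    R.V t s - G.bestValue y s +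
      G.rate t * (‖(R.xhat (t + 1) s).1 - (xs s).1‖ ^ 2 / (2 * η)) ≤ G.criticBound η ε t := by
  have hd := G.one_sub_γ_pos
  have hη := R.η_pos
  have hε := R.ε_nonneg
  have hX : ∀ t s, ‖(R.xhat t s).1 - (xs s).1‖ ^ 2 / (2 * η) ≤ 1 / η := fun t s => by
    rw [div_le_div_iff₀ (by positivity) hη]
    have := norm_sub_sq_le_two (R.xhat t s).2 (xs s).2
    nlinarith
  induction t generalizing s with
  | zero =>
    rw [R.V_init]
    have h1 := G.bestValue_nonneg y s
    have h2 := mul_le_mul_of_nonneg_left (hX (0 + 1) s) (G.rate_pos 0).le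
    have h3 : G.rate 0 * (1 / η) ≤ G.criticBound η ε 0 := by
      have hH : 0 < 2 / (1 - G.γ) := by positivity
      have h4 : 0 ≤ 7 * ε / (1 - G.γ) := by positivity
      unfold rate criticBound
      set H := 2 / (1 - G.γ)
      simp only [Nat.cast_zero, add_zero]
      have h5 : (H + 1) / H * (1 / η) ≤ 2 * (H + 1) ^ 2 / η / H := by
        rw [div_mul_div_comm, div_div, mul_comm η H]
        refine div_le_div_of_nonneg_right ?_ (by positivity)
        nlinarith
      linarith
    linarith
  | succ t ih =>
    have ihs := fun s => ih (by omega) s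
    set m := G.criticBound η ε t with hm
    have hVm : ∀ s, R.V t s ≤ G.bestValue y s + m := fun s => by
      have := ihs s
      have : 0 ≤ G.rate t * (‖(R.xhat (t + 1) s).1 - (xs s).1‖ ^ 2 / (2 * η)) :=
        mul_nonneg (rate_pos _).le (by positivity)
      linarith
    -- The comparator `xs` has loss exactly `bestValue` under the optimal continuation, hence at
    -- most `bestValue + γ m` under the critic's.
    have hxq := dotProduct_le_of_mem_simplex (xs s).2 (G.qFun_le_qFun_add y hVm s)
    rw [(G.mem_bestResponses_iff y xs).1 hxs s] at hxq
    have hopt := R.optimism_error_le ht s (xs s).2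
    have hρ := (abs_le.1 (R.abs_ρ_sub_le ht s)).2
    rw [R.V_succ ht]
    set X := ‖(R.xhat (t + 1) s).1 - (xs s).1‖ ^ 2 / (2 * η) with hXdef
    set X' := ‖(R.xhat (t + 2) s).1 - (xs s).1‖ ^ 2 / (2 * η) with hXdef'
    have hopt' : (R.x (t + 1) s).1.ofLp ⬝ᵥ G.qFun y (R.V t) s -
        (xs s).1.ofLp ⬝ᵥ G.qFun y (R.V t) s ≤
          X - X' + (6 * ε + 1 / η * G.rate t) := by
      have h6 := mul_le_mul_of_nonneg_right R.six_div_le (G.rate_pos t).le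
      have h7 : X - X' = (‖(R.xhat (t + 1) s).1 - (xs s).1‖ ^ 2 -
          ‖(R.xhat (t + 2) s).1 - (xs s).1‖ ^ 2) / (2 * η) := by
        rw [hXdef, hXdef', sub_div]
      rw [h7, ← sub_le_iff_le_add, le_div_iff₀ (by positivity)]
      have h8 := mul_le_mul_of_nonneg_left h6 (by positivity : 0 ≤ 2 * η)
      linarith
    have hα := G.rate_pos (t + 1)
    have hα' := G.rate_le_one (t := t + 1) (by omega)
    have hρ' : R.ρ (t + 1) s - G.bestValue y s ≤
        G.γ * m + (X - X') + (7 * ε + 1 / η * G.rate t) := by linarith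
    have h9 := mul_le_mul_of_nonneg_left hρ' hα.le
    have h10 := mul_le_mul_of_nonneg_left (show R.V t s - G.bestValue y s ≤ m - G.rate t * X by
      linarith [ihs s]) (sub_nonneg.2 hα')
    have hrate := G.rate_sub t
    -- The regret contributes `rate (t + 1) * X`, and the induction hypothesis removes `(1 - rate (t
    -- + 1)) * rate t * X`. The remainder is small by `rate_sub` and the diameter bound `X ≤ 1 / η`.
    have h11 : (G.rate (t + 1) - (1 - G.rate (t + 1)) * G.rate t) * X ≤
        G.rate (t + 1) * (2 / (1 - G.γ) / (2 / (1 - G.γ) + t)) * (1 / η) := by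
      rw [hrate]
      exact mul_le_mul_of_nonneg_left (hX (t + 1) s) (mul_nonneg hα.le (by positivity))
    have h12 := G.criticBound_succ hη ε t
    have h13 : 2 / (1 - G.γ) / (2 / (1 - G.γ) + t) * (1 / η) + 1 / η * G.rate t ≤
        2 * (2 / (1 - G.γ) + 1) / η / (2 / (1 - G.γ) + t) := by
      have hH : 0 < 2 / (1 - G.γ) := by positivity
      unfold rate
      set H := 2 / (1 - G.γ)
      have h14 : 0 < H + t := by positivity
      have : 2 * (H + 1) / η / (H + t) - (H / (H + t) * (1 / η) + 1 / η * ((H + 1) / (H + t))) =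
          1 / η / (H + t) := by
        field_simp; ring
      have : 0 ≤ 1 / η / (H + t) := by positivity
      linarith
    have h15 := mul_le_mul_of_nonneg_left h13 hα.le
    rw [← hm] at h12
    nlinarith

/-- No regret bound is needed on this side: any distribution has one-step loss at least `bestValue`
under the optimal continuation, so only contraction and the error `ε` matter. -/
lemma bestValue_sub_V_le {t : ℕ} (ht : t ≤ T) (s : S) :
    G.bestValue y s - R.V t s ≤ G.criticBound η ε t := by
  have hd := G.one_sub_γ_pos
  have hη := R.η_pos
  have hε := R.ε_nonneg
  have hH : 0 < 2 / (1 - G.γ) := by positivity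
  induction t generalizing s with
  | zero =>
    rw [R.V_init]
    have h1 := G.bestValue_le y (R.xhat 1) s
    have h4 : 0 ≤ 7 * ε / (1 - G.γ) := by positivity
    have h2 : 1 / (1 - G.γ) ≤ 2 * (2 / (1 - G.γ) + 1) ^ 2 / η / (2 / (1 - G.γ)) := by
      have h3 : 1 / (1 - G.γ) = 2 / (1 - G.γ) / 2 := by field_simp
      have hη1 : η ≤ 1 := R.η_le_sq.trans (by nlinarith [G.γ_nonneg])
      rw [h3]
      generalize 2 / (1 - G.γ) = H at hH
      rw [le_div_iff₀ hH, le_div_iff₀ hη]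
      have : H / 2 * H * η ≤ H / 2 * H := mul_le_of_le_one_right (by positivity) hη1
      nlinarith
    unfold criticBound
    simp only [Nat.cast_zero, add_zero]
    linarith
  | succ t ih =>
    have ihs := fun s => ih (by omega) s
    set m := G.criticBound η ε t with hm
    have hxq := dotProduct_le_of_mem_simplex (R.x (t + 1) s).2
      (G.qFun_le_qFun_add y (V := G.bestValue y) (W := R.V t) (M := m)
        (fun s => by linarith [ihs s]) s)
    have hxb := G.bestValue_le_dotProduct y (R.x (t + 1) s).2 s
    have hρ := (abs_le.1 (R.abs_ρ_sub_le ht s)).1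
    rw [R.V_succ ht]
    have hα := G.rate_pos (t + 1)
    have hα' := G.rate_le_one (t := t + 1) (by omega)
    have h9 := mul_le_mul_of_nonneg_left
      (show G.bestValue y s - R.ρ (t + 1) s ≤ G.γ * m + ε by linarith) hα.le
    have h10 := mul_le_mul_of_nonneg_left (ihs s) (sub_nonneg.2 hα')
    have h12 := G.criticBound_succ hη ε t
    have h13 : ε ≤ 2 * (2 / (1 - G.γ) + 1) / η / (2 / (1 - G.γ) + t) + 7 * ε := by
      have : 0 ≤ 2 * (2 / (1 - G.γ) + 1) / η / (2 / (1 - G.γ) + t) := by positivity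
      linarith
    have h15 := mul_le_mul_of_nonneg_left h13 hα.le
    rw [← hm] at h12
    nlinarith

/-- One step of the projected gradient method makes progress in suboptimality, up to the error
of the critic. -/
theorem two_mul_gap_le {t : ℕ} (ht1 : 1 ≤ t) (htT : t ≤ T) (s : S) {w : EuclideanSpace ℝ A}
    (hw : w ∈ G.bestResponsesAt y s) :
    2 * η * G.gap y s (R.xhat (t + 1) s).1 ≤
      ‖(R.xhat t s).1 - w‖ ^ 2 - ‖(R.xhat (t + 1) s).1 - w‖ ^ 2 +
        2 * η * (36 / (η * (1 - G.γ) ^ 2 * t) + 16 * ε / (1 - G.γ)) := by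
  obtain ⟨t, rfl⟩ : ∃ r, t = r + 1 := ⟨t - 1, by omega⟩
  have hd := G.one_sub_γ_pos
  have hη := R.η_pos
  have hε := R.ε_nonneg
  have hmem : t + 1 ∈ Finset.Icc 1 T := by simp [htT]
  have : Nonempty A := nonempty_of_mem_simplex (R.xhat 1 s).2
  obtain ⟨xs, hxs⟩ := G.exists_mem_bestResponses y
  rw [mem_bestResponsesAt_iff] at hw
  have hu := (R.xhat_update (t + 1) hmem s).two_mul_inner_le convex_simplex hw.1
  have hl := (abs_le.1 (R.abs_inner_sub_le hmem s (R.xhat (t + 2) s).2 hw.1)).1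
  rw [Nat.add_sub_cancel] at hl
  set u := R.xhat (t + 2) s
  set m := G.criticBound η ε t with hm
  have hm0 : 0 ≤ m := by rw [hm]; unfold criticBound; positivity
  have h1 := dotProduct_le_of_mem_simplex u.2
    (G.qFun_le_qFun_add y (V := G.bestValue y) (W := R.V t) (M := m)
      (fun s => by linarith [R.bestValue_sub_V_le (t := t) (by omega) s]) s)
  have h2 := dotProduct_le_of_mem_simplex hw.1
    (G.qFun_le_qFun_add y (V := R.V t) (W := G.bestValue y) (M := m)
      (fun s => by
        have := R.V_sub_bestValue_add_le hxs (t := t) (by omega) s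
        have : 0 ≤ G.rate t * (‖(R.xhat (t + 1) s).1 - (xs s).1‖ ^ 2 / (2 * η)) :=
          mul_nonneg (rate_pos _).le (by positivity)
        linarith) s)
  rw [hw.2] at h2
  have h3 : G.γ * m ≤ m := mul_le_of_le_one_left hm0 G.γ_mem.2.le
  have h4 : m ≤ _ := G.criticBound_le hη t
  have h5 : ε ≤ ε / (1 - G.γ) := by
    rw [le_div_iff₀ hd]
    exact mul_le_of_le_one_right hε (by linarith [G.γ_nonneg])
  -- The critic's error enters twice, at `u` and at `w`, giving `36 = 2 · 18` and `2 · 7`; the loss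
  -- estimate adds another `2ε`, whence `16`.
  have h6 : G.gap y s u.1 ≤ inner ℝ (u.1 - w) (R.l (t + 1) s) +
      (36 / (η * (1 - G.γ) ^ 2 * (t + 1 : ℕ)) + 16 * ε / (1 - G.γ)) := by
    unfold gap
    have e1 : 36 / (η * (1 - G.γ) ^ 2 * (t + 1 : ℕ)) =
        2 * (18 / (η * (1 - G.γ) ^ 2 * (t + 1))) := by push_cast; ring
    have e2 : 16 * ε / (1 - G.γ) = 2 * (ε / (1 - G.γ)) + 2 * (7 * ε / (1 - G.γ)) := by ring
    rw [e1, e2]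
    linarith
  have h7 := mul_le_mul_of_nonneg_left h6 (by positivity : 0 ≤ 2 * η)
  have h8 : ‖u.1 - (R.xhat (t + 1) s).1‖ ^ 2 ≥ 0 := by positivity
  linarith

end SinglePlayerRun
end MarkovGame

/-! ### Average and last-iterate rates for the actor. -/

/-- A contraction with a perturbation of order `1 / t` decays like `1 / t`. -/
lemma le_div_add_of_recursion {κ a E : ℝ} (hκ : 0 < κ) (hκ1 : κ ≤ 1) (ha : 5 ≤ a) (hE : 0 ≤ E)
    {D : ℕ → ℝ} (hD : ∀ t, D t ≤ 4) {T : ℕ}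
    (h : ∀ t, 1 ≤ t → t < T → (1 + κ) * D (t + 1) ≤ D t + a / t + κ * E)
    {t : ℕ} (ht : 1 ≤ t) (htT : t ≤ T) : D t ≤ 4 * a / κ / t + E := by
  have hN : 20 / κ ≤ 4 * a / κ := div_le_div_of_nonneg_right (by linarith) hκ.le
  have hN' : 20 ≤ 20 / κ := by rw [le_div_iff₀ hκ]; linarith
  induction t, ht using Nat.le_induction with
  | base => have := hD 1; simp only [Nat.cast_one, div_one]; linarith
  | succ t ht ih =>
    have ht0 : (1 : ℝ) ≤ t := by exact_mod_cast ht
    push_cast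
    -- For such early `t` one has `κ (t + 1) ≤ 5 ≤ a`, so the claimed bound exceeds the trivial `4`.
    -- Later, `3 κ t ≥ 4 + κ` closes the induction.
    by_cases hc : κ * t < 4
    · have h1 : 4 ≤ 4 * a / κ / (t + 1 : ℝ) := by
        rw [le_div_iff₀ (by positivity)]
        refine le_trans ?_ hN
        rw [le_div_iff₀ hκ]
        linarith
      linarith [hD (t + 1)]
    · rw [not_lt] at hc
      have h1 := h t ht (by omega)
      have h2 := ih (by omega)
      have h3 : 4 * a / κ / t + a / t ≤ (1 + κ) * (4 * a / κ / (t + 1 : ℝ)) := by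
        have e1 : 4 * a / κ / t + a / t = a * (4 + κ) / (κ * t) := by field_simp
        have e2 : (1 + κ) * (4 * a / κ / (t + 1 : ℝ)) = a * (4 * (1 + κ)) / (κ * (t + 1)) := by
          field_simp
        rw [e1, e2, div_le_div_iff₀ (by positivity) (by positivity)]
        have : 0 ≤ (a * κ) * (3 * (κ * t) - 4 - κ) :=
          mul_nonneg (by positivity) (by linarith)
        linarith
      have h4 : (1 + κ) * D (t + 1) ≤ (1 + κ) * (4 * a / κ / (t + 1 : ℝ) + E) := by linarith
      exact le_of_mul_le_mul_left h4 (by linarith)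

namespace MarkovGame

variable {G : MarkovGame S A B} {y : Policy S B}

namespace SinglePlayerRun

variable {η ε : ℝ} {T : ℕ} (R : G.SinglePlayerRun y η ε T)

lemma sum_gap_le (s : S) {n : ℕ} (hn : n + 1 ≤ T) :
    ∑ t ∈ Finset.Icc 1 (n + 1), G.gap y s (R.xhat t s).1 ≤
      1 / (1 - G.γ) + 1 / η + 36 / (η * (1 - G.γ) ^ 2) * harmonic n +
        16 * ε / (1 - G.γ) * n := by
  have hd := G.one_sub_γ_pos
  have hη := R.η_pos
  have : Nonempty A := nonempty_of_mem_simplex (R.xhat 1 s).2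
  obtain ⟨w, hw⟩ := G.bestResponsesAt_nonempty y s
  have hws := ((G.mem_bestResponsesAt_iff y s w).1 hw).1
  -- The current squared distance is kept on the left so that the induction telescopes.
  -- `two_mul_gap_le` controls the gap only after a step, so the first iterate is bounded by
  -- `gap_le`.
  suffices h : 2 * η * ∑ t ∈ Finset.Icc 1 (n + 1), G.gap y s (R.xhat t s).1 +
      ‖(R.xhat (n + 1) s).1 - w‖ ^ 2 ≤ 2 * η * (1 / (1 - G.γ)) + 2 +
        2 * η * (36 / (η * (1 - G.γ) ^ 2) * harmonic n + 16 * ε / (1 - G.γ) * n) by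
    refine le_of_mul_le_mul_left ?_ (by positivity : 0 < 2 * η)
    have e : 2 * η * (1 / η) = 2 := by field_simp
    have : 0 ≤ ‖(R.xhat (n + 1) s).1 - w‖ ^ 2 := by positivity
    linarith
  induction n with
  | zero =>
    simp only [zero_add, Finset.Icc_self, Finset.sum_singleton, harmonic_zero, Rat.cast_zero,
      Nat.cast_zero, mul_zero, add_zero]
    have h1 := mul_le_mul_of_nonneg_left (G.gap_le y (R.xhat 1) (R.xhat 1 s).2 s)
      (by positivity : 0 ≤ 2 * η)
    linarith [norm_sub_sq_le_two (R.xhat 1 s).2 hws]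
  | succ n ih =>
    have h1 := ih (by omega)
    have h2 := R.two_mul_gap_le (t := n + 1) (by omega) (by omega) s hw
    rw [Finset.sum_Icc_succ_top (by omega), harmonic_succ]
    have e : 36 / (η * (1 - G.γ) ^ 2 * ((n + 1 : ℕ) : ℝ)) =
        36 / (η * (1 - G.γ) ^ 2) * ((n + 1 : ℕ) : ℝ)⁻¹ := by field_simp
    rw [e] at h2
    push_cast at h2 ⊢
    linarith

lemma η_le_one_sub (R : G.SinglePlayerRun y η ε T) : η ≤ 1 - G.γ := by
  have hd := G.one_sub_γ_pos
  have := R.η_le_sq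
  nlinarith [G.γ_nonneg]

lemma sum_gap_le_log (s : S) (hT : 2 ≤ T) :
    ∑ t ∈ Finset.Icc 1 T, G.gap y s (R.xhat t s).1 ≤
      112 / (η * (1 - G.γ) ^ 2) * Real.log T + 16 * ε / (1 - G.γ) * T := by
  obtain ⟨n, rfl⟩ : ∃ n, T = n + 1 := ⟨T - 1, by omega⟩
  have hd := G.one_sub_γ_pos
  have hη := R.η_pos
  have hε := R.ε_nonneg
  have h := R.sum_gap_le s (n := n) le_rfl
  have hlog : 1 ≤ 2 * Real.log ((n + 1 : ℕ) : ℝ) := by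
    have h1 : Real.log 2 ≤ Real.log ((n + 1 : ℕ) : ℝ) :=
      Real.log_le_log (by norm_num) (by exact_mod_cast hT)
    linarith [Real.log_two_gt_d9]
  have hharm : (harmonic n : ℝ) ≤ 1 + Real.log ((n + 1 : ℕ) : ℝ) := by
    refine (harmonic_le_one_add_log n).trans (add_le_add_right ?_ _)
    exact Real.log_le_log (by exact_mod_cast (by omega : 0 < n)) (by push_cast; linarith)
  set L := Real.log ((n + 1 : ℕ) : ℝ)
  have h1 : 1 / (1 - G.γ) ≤ 1 / η := one_div_le_one_div_of_le hη R.η_le_one_sub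
  have h2 : 1 / η ≤ 1 / (η * (1 - G.γ) ^ 2) := by
    refine one_div_le_one_div_of_le (by positivity) (mul_le_of_le_one_right hη.le ?_)
    exact pow_le_one₀ hd.le (by linarith [G.γ_nonneg])
  have hq : 0 < 1 / (η * (1 - G.γ) ^ 2) := by positivity
  have e1 : 36 / (η * (1 - G.γ) ^ 2) = 36 * (1 / (η * (1 - G.γ) ^ 2)) := by ring
  have e2 : 112 / (η * (1 - G.γ) ^ 2) = 112 * (1 / (η * (1 - G.γ) ^ 2)) := by ring
  rw [e1] at h
  rw [e2]
  set q := 1 / (η * (1 - G.γ) ^ 2)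
  have h3 : 16 * ε / (1 - G.γ) * n ≤ 16 * ε / (1 - G.γ) * ((n + 1 : ℕ) : ℝ) := by
    refine mul_le_mul_of_nonneg_left (by push_cast; linarith) (by positivity)
  -- `112 = 36 · 3 + 4`, the `4` coming from `1 / (1 - γ) + 1 / η ≤ 2 q ≤ 4 q L`.
  have h4 : q * harmonic n ≤ q * (3 * L) := mul_le_mul_of_nonneg_left (by linarith) hq.le
  have h5 : q * 1 ≤ q * (2 * L) := mul_le_mul_of_nonneg_left hlog hq.le
  linarith

/-- The average suboptimality of the iterates `x̂_t` against `y`. -/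
theorem average_suboptimality_le (hT : 2 ≤ T) :
    (1 / (T : ℝ)) * ∑ t ∈ Finset.Icc 1 T,
        (⨆ q : S × Policy S A, (G.value (R.xhat t) y q.1 - G.value q.2 y q.1))
      ≤ 288 * ((Fintype.card S : ℝ) / (η * (1 - G.γ) ^ 2) * √(Real.log T / T)
          + (Fintype.card S : ℝ) * √ε / (√η * (1 - G.γ) ^ 2)) := by
  have hd := G.one_sub_γ_pos
  have hd1 : 1 - G.γ ≤ 1 := by linarith [G.γ_nonneg]
  have hη := R.η_pos
  have hε := R.ε_nonneg
  have hS : (1 : ℝ) ≤ Fintype.card S := by exact_mod_cast R.card_pos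
  have hT0 : (0 : ℝ) < T := by exact_mod_cast (by omega : 0 < T)
  have : Nonempty S := Fintype.card_pos_iff.1 R.card_pos
  have hlog : 0 ≤ Real.log T := Real.log_natCast_nonneg T
  set N := (Fintype.card S : ℝ)
  set d := 1 - G.γ
  set r := √(Real.log T / T) with hr
  have hr0 : 0 ≤ r := Real.sqrt_nonneg _
  have hrsq : r ^ 2 = Real.log T / T := Real.sq_sqrt (by positivity)
  set g : ℕ → ℝ := fun t => ⨆ q : S × Policy S A, (G.value (R.xhat t) y q.1 - G.value q.2 y q.1)
  have hg1 : ∀ t, g t ≤ 1 / d := fun t => by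
    have : Nonempty (S × Policy S A) := ⟨(Classical.arbitrary S, R.xhat t)⟩
    exact ciSup_le fun q => by linarith [G.value_le y (R.xhat t) q.1, G.value_nonneg y q.2 q.1]
  -- Replacing the largest gap by the sum over states allows summing over time state by state; this
  -- is the source of the factor `N`.
  have hg2 : ∀ t, g t ≤ (∑ s, G.gap y s (R.xhat t s).1) / d := fun t => by
    have : Nonempty (S × Policy S A) := ⟨(Classical.arbitrary S, R.xhat t)⟩
    refine ciSup_le fun q => ?_
    have h1 := G.value_sub_le y (V := G.bestValue y) (x := R.xhat t)
      (g := ∑ s, G.gap y s (R.xhat t s).1) (fun s => by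
        have := Finset.single_le_sum (f := fun s => G.gap y s (R.xhat t s).1)
          (fun s _ => G.gap_nonneg y (R.xhat t s).2 s) (Finset.mem_univ s)
        have e : (R.xhat t s).1.ofLp ⬝ᵥ G.qFun y (G.bestValue y) s =
          G.bestValue y s + G.gap y s (R.xhat t s).1 := by unfold gap; ring
        rw [e]
        linarith) q.1
    linarith [G.bestValue_le_value y q.2 q.1]
  have hεterm : 16 * N * ε / d ^ 2 ≤ 16 * (N * √ε / (√η * d ^ 2)) := by
    have hsη : 0 < √η := Real.sqrt_pos.2 hη
    have h1 : √ε * √η ≤ 1 := by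
      rw [← Real.sqrt_mul hε, Real.sqrt_le_iff, one_pow]
      refine ⟨zero_le_one, ?_⟩
      have := R.ε_le
      rw [le_div_iff₀ hd] at this
      exact (mul_le_mul_of_nonneg_left R.η_le_one_sub hε).trans this
    have h2 : √ε ≤ 1 / √η := by rwa [le_div_iff₀ hsη]
    calc 16 * N * ε / d ^ 2 = 16 * N * √ε / d ^ 2 * √ε := by
          nth_rewrite 1 [← Real.mul_self_sqrt hε]; ring
      _ ≤ 16 * N * √ε / d ^ 2 * (1 / √η) := mul_le_mul_of_nonneg_left h2 (by positivity)
      _ = _ := by field_simp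
  have hpos2 : 0 ≤ N * √ε / (√η * d ^ 2) := by positivity
  have hpos1 : 0 ≤ N / (η * d ^ 2) * r := by positivity
  -- The regret bound yields `r ^ 2 / d`, which is at most `r` when `r ≤ d`. Otherwise the trivial
  -- bound `1 / d` on suboptimality already suffices.
  by_cases hc : r ≤ d
  · have hsum : ∑ t ∈ Finset.Icc 1 T, g t ≤
        N * (112 / (η * d ^ 2) * Real.log T + 16 * ε / d * T) / d := by
      calc ∑ t ∈ Finset.Icc 1 T, g t
          ≤ ∑ t ∈ Finset.Icc 1 T, (∑ s, G.gap y s (R.xhat t s).1) / d :=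
            Finset.sum_le_sum fun t _ => hg2 t
        _ = (∑ s, ∑ t ∈ Finset.Icc 1 T, G.gap y s (R.xhat t s).1) / d := by
            rw [← Finset.sum_div, Finset.sum_comm]
        _ ≤ (∑ _s : S, (112 / (η * d ^ 2) * Real.log T + 16 * ε / d * T)) / d :=
            div_le_div_of_nonneg_right
              (Finset.sum_le_sum fun s _ => R.sum_gap_le_log s hT) hd.le
        _ = _ := by rw [Finset.sum_const, Finset.card_univ, nsmul_eq_mul]
    have h1 := mul_le_mul_of_nonneg_left hsum (by positivity : 0 ≤ 1 / (T : ℝ))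
    have e : 1 / (T : ℝ) * (N * (112 / (η * d ^ 2) * Real.log T + 16 * ε / d * T) / d) =
        112 * (N / (η * d ^ 2) * (r ^ 2 / d)) + 16 * N * ε / d ^ 2 := by
      rw [hrsq]; field_simp
    have h2 : N / (η * d ^ 2) * (r ^ 2 / d) ≤ N / (η * d ^ 2) * r := by
      refine mul_le_mul_of_nonneg_left ?_ (by positivity)
      rw [div_le_iff₀ hd]
      nlinarith
    rw [e] at h1
    linarith
  · rw [not_le] at hc
    have hsum : ∑ t ∈ Finset.Icc 1 T, g t ≤ T * (1 / d) := by
      refine (Finset.sum_le_sum fun t _ => hg1 t).trans ?_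
      simp
    have h1 := mul_le_mul_of_nonneg_left hsum (by positivity : 0 ≤ 1 / (T : ℝ))
    have e : 1 / (T : ℝ) * (T * (1 / d)) = 1 / d := by field_simp
    have h2 : 1 / d ≤ N / (η * d ^ 2) * r := by
      rw [div_mul_eq_mul_div, div_le_div_iff₀ hd (by positivity)]
      have hη1 : η ≤ 1 := R.η_le_one_sub.trans hd1
      have h3 : d ≤ N * r := hc.le.trans (le_mul_of_one_le_left hr0 hS)
      have h4 : η * d ≤ N * r := (mul_le_of_le_one_left hd.le hη1).trans h3
      have h5 := mul_le_mul_of_nonneg_right h4 hd.le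
      nlinarith
    rw [e] at h1
    linarith

/-- Last-iterate bound on the squared distance to the best responses. -/
lemma sq_infDist_le {C : ℝ} (hC0 : 0 < C) (hC : G.IsErrorBoundConst y C)
    (hCle : C ≤ 1 / (1 - G.γ)) (s : S) {t : ℕ} (ht : 1 ≤ t) (htT : t ≤ T) :
    Metric.infDist (R.xhat t s).1 (G.bestResponsesAt y s) ^ 2 ≤
      4 * (72 / (1 - G.γ) ^ 2) / (η * C) / t + 32 * ε / ((1 - G.γ) * C) := by
  have hd := G.one_sub_γ_pos
  have hη := R.η_pos
  have hε := R.ε_nonneg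
  have : Nonempty A := nonempty_of_mem_simplex (R.xhat 1 s).2
  have hne := G.bestResponsesAt_nonempty y s
  have hcpt := G.isCompact_bestResponsesAt y s
  have hbd : ∀ t, Metric.infDist (R.xhat t s).1 (G.bestResponsesAt y s) ≤ 2 := fun t => by
    obtain ⟨w, hw⟩ := hne
    refine (Metric.infDist_le_dist_of_mem hw).trans ?_
    rw [dist_eq_norm]
    exact norm_sub_le_two (R.xhat t s).2 ((G.mem_bestResponsesAt_iff y s w).1 hw).1
  have hκ1 : η * C ≤ 1 := by
    rw [le_div_iff₀ hd] at hCle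
    have := mul_le_mul_of_nonneg_left R.η_le_one_sub hC0.le
    linarith
  have ha : 5 ≤ 72 / (1 - G.γ) ^ 2 := by
    rw [le_div_iff₀ (by positivity)]
    nlinarith [G.γ_nonneg]
  refine le_div_add_of_recursion (D := fun t =>
    Metric.infDist (R.xhat t s).1 (G.bestResponsesAt y s) ^ 2) (by positivity) hκ1 ha
    (by positivity) (fun t => ?_) (fun t ht htT => ?_) ht htT
  · have := hbd t
    have := Metric.infDist_nonneg (x := (R.xhat t s).1) (s := G.bestResponsesAt y s)
    nlinarith
  · obtain ⟨w, hw, hwd⟩ := hcpt.exists_infDist_eq_dist hne (R.xhat t s).1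
    have h1 := R.two_mul_gap_le ht htT.le s hw
    rw [← dist_eq_norm, ← dist_eq_norm, ← hwd] at h1
    have h2 := (G.isErrorBoundConst_iff y C).1 hC s _ (R.xhat (t + 1) s).2
    have h3 : Metric.infDist (R.xhat (t + 1) s).1 (G.bestResponsesAt y s) ≤
      dist (R.xhat (t + 1) s).1 w := Metric.infDist_le_dist_of_mem hw
    have h4 := hbd (t + 1)
    have h5 := Metric.infDist_nonneg (x := (R.xhat (t + 1) s).1) (s := G.bestResponsesAt y s)
    have ht0 : (0 : ℝ) < t := by exact_mod_cast ht
    have e : 2 * η * (36 / (η * (1 - G.γ) ^ 2 * t) + 16 * ε / (1 - G.γ)) =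
        72 / (1 - G.γ) ^ 2 / t + η * C * (32 * ε / ((1 - G.γ) * C)) := by
      field_simp
      ring
    rw [e] at h1
    set D := Metric.infDist (R.xhat (t + 1) s).1 (G.bestResponsesAt y s)
    have h6 : D ^ 2 ≤ dist (R.xhat (t + 1) s).1 w ^ 2 := pow_le_pow_left₀ h5 h3 2
    -- As `D ≤ 2`, the linear error bound implies a quadratic one, which turns the progress
    -- inequality into a contraction of `D ^ 2` with `κ = η C`.
    have h7 : η * C * D ^ 2 ≤ 2 * η * (C * D) := by
      have : η * C * D * D ≤ η * C * D * 2 := mul_le_mul_of_nonneg_left h4 (by positivity)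
      linarith
    have h8 := mul_le_mul_of_nonneg_left h2 (by positivity : 0 ≤ 2 * η)
    linarith

lemma sq_infDist_le_of_isErrorBoundConst {C : ℝ} (hC0 : 0 < C) (hC : G.IsErrorBoundConst y C)
    (hT : 1 ≤ T) (s : S) :
    Metric.infDist (R.xhat T s).1 (G.bestResponsesAt y s) ^ 2 ≤
      288 * ((Fintype.card S : ℝ) ^ 2 / (η ^ 4 * C ^ 4 * (1 - G.γ) ^ 4 * T)
        + ε / (η * C ^ 2 * (1 - G.γ) ^ 3)) := by
  have hd := G.one_sub_γ_pos
  have hd1 : 1 - G.γ ≤ 1 := by linarith [G.γ_nonneg]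
  have hη := R.η_pos
  have hε := R.ε_nonneg
  have hT0 : (0 : ℝ) < T := by exact_mod_cast hT
  rcases G.mem_bestResponsesAt_or_le y hC hC0 (R.xhat T) s with hmem | hCle
  · rw [Metric.infDist_zero_of_mem hmem, zero_pow two_ne_zero]
    positivity
  · refine (R.sq_infDist_le hC0 hC hCle s hT le_rfl).trans ?_
    have hS : (1 : ℝ) ≤ Fintype.card S := by exact_mod_cast R.card_pos
    have hκ1 : η * C ≤ 1 := by
      rw [le_div_iff₀ hd] at hCle
      have := mul_le_mul_of_nonneg_left R.η_le_one_sub hC0.le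
      linarith
    -- The bound obtained is sharper than the stated one; since `η C ≤ 1`, `1 - γ ≤ 1` and there is
    -- at least one state, it may be weakened to it.
    have h1 : 4 * (72 / (1 - G.γ) ^ 2) / (η * C) / T ≤
        288 * ((Fintype.card S : ℝ) ^ 2 / (η ^ 4 * C ^ 4 * (1 - G.γ) ^ 4 * T)) := by
      have e : 4 * (72 / (1 - G.γ) ^ 2) / (η * C) / T =
          288 * (((η * C) ^ 3 * (1 - G.γ) ^ 2) / (η ^ 4 * C ^ 4 * (1 - G.γ) ^ 4 * T)) := by
        field_simp
        norm_num
      rw [e]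
      refine mul_le_mul_of_nonneg_left (div_le_div_of_nonneg_right ?_ (by positivity))
        (by norm_num)
      calc (η * C) ^ 3 * (1 - G.γ) ^ 2 ≤ 1 :=
            mul_le_one₀ (pow_le_one₀ (by positivity) hκ1) (by positivity)
              (pow_le_one₀ hd.le hd1)
        _ ≤ _ := one_le_pow₀ hS
    have h2 : 32 * ε / ((1 - G.γ) * C) ≤ 288 * (ε / (η * C ^ 2 * (1 - G.γ) ^ 3)) := by
      have e : 32 * ε / ((1 - G.γ) * C) =
          32 * ((η * C) * (1 - G.γ) ^ 2) * (ε / (η * C ^ 2 * (1 - G.γ) ^ 3)) := by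
        field_simp
      rw [e]
      refine mul_le_mul_of_nonneg_right ?_ (by positivity)
      have : (η * C) * (1 - G.γ) ^ 2 ≤ 1 :=
        mul_le_one₀ hκ1 (by positivity) (pow_le_one₀ hd.le hd1)
      linarith
    linarith

/-- Last-iterate convergence of `x̂_T` to the set of best responses. -/
theorem exists_proj_bestResponses {C : ℝ} (hC0 : 0 < C) (hC : G.IsErrorBoundConst y C)
    (hT : 1 ≤ T) :
    ∃ xbar ∈ G.bestResponses y,
      (∀ s, IsProj (G.bestResponsesAt y s) (R.xhat T s).1 (xbar s).1) ∧
      (1 / (Fintype.card S : ℝ)) * ∑ s, ‖(R.xhat T s).1 - (xbar s).1‖ ^ 2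
        ≤ 288 * ((Fintype.card S : ℝ) ^ 2 / (η ^ 4 * C ^ 4 * (1 - G.γ) ^ 4 * T)
            + ε / (η * C ^ 2 * (1 - G.γ) ^ 3)) := by
  have hex : ∀ s, ∃ w ∈ G.bestResponsesAt y s,
      Metric.infDist (R.xhat T s).1 (G.bestResponsesAt y s) = dist (R.xhat T s).1 w := fun s => by
    have : Nonempty A := nonempty_of_mem_simplex (R.xhat T s).2
    exact (G.isCompact_bestResponsesAt y s).exists_infDist_eq_dist
      (G.bestResponsesAt_nonempty y s) _
  choose w hw hwd using hex
  have hw' := fun s => (G.mem_bestResponsesAt_iff y s (w s)).1 (hw s)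
  refine ⟨fun s => ⟨w s, (hw' s).1⟩, (G.mem_bestResponses_iff y _).2 fun s => (hw' s).2,
    fun s => ⟨hw s, fun z hz => ?_⟩, ?_⟩
  · rw [norm_sub_rev, norm_sub_rev z, ← dist_eq_norm, ← dist_eq_norm, ← hwd s]
    exact Metric.infDist_le_dist_of_mem hz
  · have hS : (0 : ℝ) < Fintype.card S := by exact_mod_cast R.card_pos
    rw [one_div, inv_mul_le_iff₀ hS, ← nsmul_eq_mul, ← Finset.card_univ, ← Finset.sum_const]
    refine Finset.sum_le_sum fun s _ => ?_
    rw [← dist_eq_norm, ← hwd s, Finset.card_univ]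
    exact R.sq_infDist_le_of_isErrorBoundConst hC0 hC hT s

end SinglePlayerRun
end MarkovGame

end ZeroSum

end

theorem mainTheorem3 :
    ∃ K : ℝ, 0 < K ∧
      ∀ (S : Type u) (A : Type v) (B : Type w) [Fintype S] [Fintype A] [Fintype B]
        (G : ZeroSum.MarkovGame S A B) (y : ZeroSum.Policy S B),
        -- average suboptimality against `y`
        (∀ (η ε : ℝ) (T : ℕ) (R : G.SinglePlayerRun y η ε T), 2 ≤ T →
          (1 / (T : ℝ)) * ∑ t ∈ Finset.Icc 1 T,
              (⨆ q : S × ZeroSum.Policy S A, (G.value (R.xhat t) y q.1 - G.value q.2 y q.1))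
            ≤ K * ((Fintype.card S : ℝ) / (η * (1 - G.γ) ^ 2) * √(Real.log T / T)
                + (Fintype.card S : ℝ) * √ε / (√η * (1 - G.γ) ^ 2))) ∧
        -- last-iterate distance to the set of best responses
        (∃ C' : ℝ, 0 < C' ∧ G.IsErrorBoundConst y C') ∧
        (∀ C' : ℝ, 0 < C' → G.IsErrorBoundConst y C' →
          ∀ (η ε : ℝ) (T : ℕ) (R : G.SinglePlayerRun y η ε T), 1 ≤ T →
            ∃ xbar ∈ G.bestResponses y,
              (∀ s, ZeroSum.IsProj (G.bestResponsesAt y s) (R.xhat T s).1 (xbar s).1) ∧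
              (1 / (Fintype.card S : ℝ)) * ∑ s, ‖(R.xhat T s).1 - (xbar s).1‖ ^ 2
                ≤ K * ((Fintype.card S : ℝ) ^ 2 / (η ^ 4 * C' ^ 4 * (1 - G.γ) ^ 4 * T)
                    + ε / (η * C' ^ 2 * (1 - G.γ) ^ 3))) := by
  refine ⟨288, by norm_num, fun S A B _ _ _ G y => ⟨fun η ε T R hT => ?_, ?_, ?_⟩⟩
  · exact R.average_suboptimality_le hT
  · exact G.exists_isErrorBoundConst y
  · intro C' hC0 hC η ε T R hT
    exact R.exists_proj_bestResponses hC0 hC hT
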